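/- Let $n\ge 1$, let $\Omega\subset\mathbb R^n$ be open and bounded, and let $\alpha:\mathbb R^n\times\mathbb R^n\to\mathbb R^n$ be measurable and antisymmetric, $\alpha(x,y)=-\alpha(y,x)$. Put $\gamma(x,y)=\alpha(x,y)\cdot\alpha(x,y)$, $\mathcal D^*(v)(x,y)=-(v(y)-v(x))\,\alpha(x,y)$, $\Omega_{\mathcal I}=\{y\in\mathbb R^n\setminus\Omega:\ \alpha(x,y)\ne 0\text{ for some }x\in\Omega\}$ and $D=\Omega\cup\Omega_{\mathcal I}$. Assume that, for some constants $\varepsilon>0$ and $\gamma_0>0$: $\alpha(x,y)\neq 0$ whenever $x\in\Omega$, $y\notin\Omega$ and $|y-x|<\varepsilon$; and, for all $x,y\in D$, $\gamma(x,y)\ge\gamma_0$ if $0<|y-x|\le\varepsilon/2$, and $\gamma(x,y)=0$ if $|y-x|>\varepsilon$. (Thus $\Omega_{\mathcal I}$ is the set of points outside $\Omega$ at distance less than $\varepsilon$ from $\Omega$.) Assume moreover that there are constants $c_1,c_2>0$ with $$\frac{c_1}{|y-x|^{r}}\le\gamma(x,y)\le\frac{c_2}{|y-x|^{r}}\qquad\text{for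 all }x,y\in D\text{ with }0<|y-x|\le\varepsilon,$$ where either $r=n+2s$ for some $s\in(0,1)$, or $r=n$. Let $|||v|||^2=\int_D\int_D \mathcal D^*v\cdot\mathcal D^*v\,dy\,dx$, $V=\{v\in L^2(D):|||v|||<\infty\}$ and $V_c=\{v\in V: v=0\text{ a.e. on }\Omega_{\mathcal I}\}$. Let $\vartheta_0>0$, let $\vartheta_1,K$ be real constants, and let $$\mathcal C=\{\vartheta\in W^{1,\infty}(D\times D):\ \vartheta_0\le\vartheta\le\vartheta_1\text{ a.e.},\ \|\vartheta\|_{1,\infty}\le K\},$$ where $\|\vartheta\|_{1,\infty}$ is the maximum of the $L^\infty$ norms of $\vartheta$ and of its $2n$ weak first partial derivatives. Assume that $\mathcal C$ is nonempty. Let $f$ be a linear functional on $V_c$ that is bounded with respect to $|||\cdot|||$ (its value at $v$ is written $\int_\Omega f v\,dx$), and let $\widehat u\in L^2(\Omega)$. Consider the problem of minimizing $$J(u,\vartheta)=\frac12\int_\Omega (u-\widehat u)^2\,dx$$ over all pairs $(u,\vartheta)$ such that $\vartheta\in\mathcal C$, $u\in V_c$, and $$\int_D\int_D\vartheta\,\mathcal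 D^*u\cdot\mathcal D^*v\,dy\,dx=\int_\Omega f v\,dx\qquad\text{for all }v\in V_c .$$ **Theorem.** This problem has at least one solution: there is a pair $(u^*,\vartheta^*)$ satisfying these constraints with $J(u^*,\vartheta^*)\le J(u,\vartheta)$ for every pair $(u,\vartheta)$ satisfying them. Moreover, $\vartheta^*$ can be chosen symmetric, $\vartheta^*(x,y)=\vartheta^*(y,x)$ for almost every $(x,y)\in D\times D$. -/

import Mathlib

open MeasureTheory
open scoped ContDiff ENNReal

noncomputable section

namespace NonlocalControl

/-- `ℝⁿ` with its Euclidean norm. -/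
abbrev Rn (n : ℕ) : Type := EuclideanSpace ℝ (Fin n)

variable {n : ℕ}

/-- The adjoint `𝒟*` of the nonlocal divergence:
`𝒟*(v)(x, y) = -(v(y) - v(x)) α(x, y)`. -/
def nonlocalAdj (α : Rn n → Rn n → Rn n) (v : Rn n → ℝ) (x y : Rn n) : Rn n :=
  -((v y - v x) • α x y)

/-- The kernel `γ(x, y) = α(x, y) · α(x, y)`; it is nonnegative by construction. -/
def kernel (α : Rn n → Rn n → Rn n) (x y : Rn n) : ℝ :=
  inner ℝ (α x y) (α x y)

/-- The interaction domain `Ω_I`: the points outside `Ω` that interact with a point of `Ω`. -/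
def interactionDomain (Ω : Set (Rn n)) (α : Rn n → Rn n → Rn n) : Set (Rn n) :=
  {y | y ∉ Ω ∧ ∃ x ∈ Ω, α x y ≠ 0}

/-- `Ω ∪ Ω_I`. -/
def totalDomain (Ω : Set (Rn n)) (α : Rn n → Rn n → Rn n) : Set (Rn n) :=
  Ω ∪ interactionDomain Ω α

/-- `(Ω ∪ Ω_I) × (Ω ∪ Ω_I)`. -/
def pairDomain (Ω : Set (Rn n)) (α : Rn n → Rn n → Rn n) : Set (Rn n × Rn n) :=
  totalDomain Ω α ×ˢ totalDomain Ω α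

/-- The general conditions on the kernel with interaction radius `ε` and lower bound `γ₀`.
The diagonal is left out of the lower bound, because `α x x = 0` for antisymmetric `α`. -/
structure KernelConditions (Ω : Set (Rn n)) (α : Rn n → Rn n → Rn n) (ε γ₀ : ℝ) : Prop where
  antisymm : ∀ x y, α x y = -α y x
  measurable : Measurable fun p : Rn n × Rn n => α p.1 p.2
  /-- Points of `Ω` interact with all points outside `Ω` at distance less than `ε`
  (so that `Ω_I` is the collar of width `ε` around `Ω`). -/
  interacts : ∀ x ∈ Ω, ∀ y ∉ Ω, ‖y - x‖ < ε → α x y ≠ 0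
  lower : ∀ x ∈ totalDomain Ω α, ∀ y ∈ totalDomain Ω α,
    y ≠ x → ‖y - x‖ ≤ ε / 2 → γ₀ ≤ kernel α x y
  vanishes : ∀ x ∈ totalDomain Ω α, ∀ y ∈ totalDomain Ω α,
    ε < ‖y - x‖ → kernel α x y = 0

/-- `γ(x, y)` lies between two positive multiples of `|y - x|⁻ʳ` whenever `0 < |y - x| ≤ ε`. -/
def KernelSingularity (Ω : Set (Rn n)) (α : Rn n → Rn n → Rn n) (ε r : ℝ) : Prop :=
  ∃ c₁ c₂ : ℝ, 0 < c₁ ∧ 0 < c₂ ∧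
    ∀ x ∈ totalDomain Ω α, ∀ y ∈ totalDomain Ω α, y ≠ x → ‖y - x‖ ≤ ε →
      c₁ / ‖y - x‖ ^ r ≤ kernel α x y ∧ kernel α x y ≤ c₂ / ‖y - x‖ ^ r

/-- Case 1: fractional kernels, `γ(x, y) ~ |y - x|^{-(n + 2s)}` for some `s ∈ (0, 1)`. -/
def KernelCase1 (Ω : Set (Rn n)) (α : Rn n → Rn n → Rn n) (ε : ℝ) : Prop :=
  ∃ s : ℝ, 0 < s ∧ s < 1 ∧ KernelSingularity Ω α ε ((n : ℝ) + 2 * s)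

/-- Case 2: `γ(x, y) ~ |y - x|^{-n}`. -/
def KernelCase2 (Ω : Set (Rn n)) (α : Rn n → Rn n → Rn n) (ε : ℝ) : Prop :=
  KernelSingularity Ω α ε (n : ℝ)

/-- The energy seminorm, `|||v|||² = ∫∫ 𝒟*v · 𝒟*v dy dx` over `(Ω ∪ Ω_I)²`. -/
def energyNorm (Ω : Set (Rn n)) (α : Rn n → Rn n → Rn n) (v : Rn n → ℝ) : ℝ :=
  Real.sqrt (∫ p in pairDomain Ω α,
    inner ℝ (nonlocalAdj α v p.1 p.2) (nonlocalAdj α v p.1 p.2))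

/-- The energy space `V(Ω ∪ Ω_I)`: `v ∈ L²(Ω ∪ Ω_I)` and `|||v||| < ∞`, i.e. `𝒟*v` is square
integrable on `(Ω ∪ Ω_I)²`. Elements are functions on `ℝⁿ`; only their values almost everywhere
on `Ω ∪ Ω_I` matter. -/
def energySpace (Ω : Set (Rn n)) (α : Rn n → Rn n → Rn n) : Submodule ℝ (Rn n → ℝ) where
  carrier := {v | MemLp v 2 (volume.restrict (totalDomain Ω α)) ∧
    MemLp (fun p : Rn n × Rn n => nonlocalAdj α v p.1 p.2) 2
      (volume.restrict (pairDomain Ω α))}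
  zero_mem' := by
    refine ⟨MemLp.zero, ?_⟩
    simp [nonlocalAdj]
  add_mem' := by
    rintro u v ⟨hu, hu2⟩ ⟨hv, hv2⟩
    refine ⟨hu.add hv, ?_⟩
    convert hu2.add hv2 using 1
    funext p
    simp only [nonlocalAdj, Pi.add_apply]
    module
  smul_mem' := by
    rintro c v ⟨hv, hv2⟩
    refine ⟨hv.const_smul c, ?_⟩
    have h : (fun p : Rn n × Rn n => nonlocalAdj α (c • v) p.1 p.2) =
        c • fun p : Rn n × Rn n => nonlocalAdj α v p.1 p.2 := by
      funext p
      simp only [nonlocalAdj, Pi.smul_apply, smul_eq_mul]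
      module
    rw [h]
    exact hv2.const_smul c

/-- The volume-constrained energy space `V_c(Ω ∪ Ω_I) = {v ∈ V : v = 0 on Ω_I}`. -/
def constrainedSpace (Ω : Set (Rn n)) (α : Rn n → Rn n → Rn n) : Submodule ℝ (Rn n → ℝ) where
  carrier := {v | v ∈ energySpace Ω α ∧
    ∀ᵐ x ∂(volume.restrict (interactionDomain Ω α)), v x = 0}
  zero_mem' := ⟨Submodule.zero_mem _, by simp⟩
  add_mem' := by
    rintro u v ⟨hu, hu2⟩ ⟨hv, hv2⟩
    refine ⟨Submodule.add_mem _ hu hv, ?_⟩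
    filter_upwards [hu2, hv2] with x h1 h2
    simp [h1, h2]
  smul_mem' := by
    rintro c v ⟨hv, hv2⟩
    refine ⟨Submodule.smul_mem _ c hv, ?_⟩
    filter_upwards [hv2] with x h
    simp [h]

/-- `f` belongs to the dual `V_c'` of `(V_c, |||·|||)`: the linear functional `f`, which stands
for the duality pairing `v ↦ ∫_Ω f v dx`, is bounded in the energy norm. -/
def IsEnergyBounded (Ω : Set (Rn n)) (α : Rn n → Rn n → Rn n)
    (f : constrainedSpace Ω α →ₗ[ℝ] ℝ) : Prop :=
  ∃ M : ℝ, ∀ v : constrainedSpace Ω α, |f v| ≤ M * energyNorm Ω α v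

/-- `g` is the weak derivative of `θ` in the direction `w` on the open set `U`. -/
def HasWeakDirDeriv {F : Type*} [NormedAddCommGroup F] [NormedSpace ℝ F] [MeasureSpace F]
    (U : Set F) (θ g : F → ℝ) (w : F) : Prop :=
  ∀ φ : F → ℝ, ContDiff ℝ ∞ φ → HasCompactSupport φ → tsupport φ ⊆ U →
    ∫ p in U, θ p * fderiv ℝ φ p w = -∫ p in U, g p * φ p

/-- The `2n` coordinate directions of `ℝⁿ × ℝⁿ`. -/
def coordDir : Fin n ⊕ Fin n → Rn n × Rn n :=
  Sum.elim (fun i => (EuclideanSpace.single i 1, 0)) (fun i => (0, EuclideanSpace.single i 1))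

/-- `θ ∈ W^{1,∞}(U)` and `‖θ‖_{1,∞} ≤ K`, where
`‖θ‖_{1,∞} = max (‖θ‖_∞, max_k ‖∂_k θ‖_∞)` with weak partial derivatives
(which are unique almost everywhere). -/
def W1InftyNormLE (U : Set (Rn n × Rn n)) (θ : Rn n × Rn n → ℝ) (K : ℝ) : Prop :=
  MemLp θ ∞ (volume.restrict U) ∧
  eLpNorm θ ∞ (volume.restrict U) ≤ ENNReal.ofReal K ∧
  ∀ k : Fin n ⊕ Fin n, ∃ g : Rn n × Rn n → ℝ,
    MemLp g ∞ (volume.restrict U) ∧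
    HasWeakDirDeriv U θ g (coordDir k) ∧
    eLpNorm g ∞ (volume.restrict U) ≤ ENNReal.ofReal K

/-- The set `𝒞` of admissible diffusivities. -/
def admissible (Ω : Set (Rn n)) (α : Rn n → Rn n → Rn n) (θ₀ θ₁ K : ℝ) :
    Set (Rn n × Rn n → ℝ) :=
  {θ | W1InftyNormLE (pairDomain Ω α) θ K ∧
    ∀ᵐ p ∂(volume.restrict (pairDomain Ω α)), θ₀ ≤ θ p ∧ θ p ≤ θ₁}

/-- `u` solves the weak nonlocal diffusion problem with diffusivity `θ`, source `f` and `g = 0`: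
`u ∈ V`, `u = 0` on `Ω_I`, and `∫∫ θ 𝒟*u · 𝒟*v dy dx = ⟨f, v⟩` for all `v ∈ V_c`. -/
def IsWeakSolution (Ω : Set (Rn n)) (α : Rn n → Rn n → Rn n)
    (f : constrainedSpace Ω α →ₗ[ℝ] ℝ) (θ : Rn n × Rn n → ℝ) (u : Rn n → ℝ) : Prop :=
  u ∈ constrainedSpace Ω α ∧
  ∀ v : constrainedSpace Ω α,
    ∫ p in pairDomain Ω α,
      θ p * inner ℝ (nonlocalAdj α u p.1 p.2) (nonlocalAdj α v p.1 p.2) = f v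

/-- The cost functional `½ ∫_Ω (u - û)² dx`. -/
def cost (Ω : Set (Rn n)) (uhat u : Rn n → ℝ) : ℝ :=
  (1 / 2) * ∫ x in Ω, (u x - uhat x) ^ 2

end NonlocalControl

end

open NonlocalControl

/-! The proof is the direct method, with compactness taken from the diffusivities alone.

*Compactness.* Let `θ_k` be admissible. They and their weak partial derivatives are uniformly
bounded, so they converge weakly in `L²(D × D)` along subsequences, and the limit `θ` obeys the same
bounds (`exists_subseq_weak_limit_of_bounded`). A function with bounded weak gradient is Lipschitz
on balls inside the domain (`WeakGradientLE.ae_lipschitz`), hence uniformly close to its averages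
over small balls; the averages converge by weak convergence, so `θ_k → θ` almost everywhere
(`tendsto_ae_of_weak_of_weakGradientLE`, `exists_subseq_tendsto_ae_of_W1InftyNormLE`).

*Solvability.* `D` is the open `ε`-neighbourhood of `Ω`, and the lower bound `γ ≥ γ₀` near the
diagonal gives a Poincaré inequality on `V_c` (`exists_poincare`). Hence `V_c` is complete in the
energy norm (`isClosed_range_adjMap`), and the Lax-Milgram theorem provides a weak solution for
every admissible diffusivity (`exists_isWeakSolution`).

*Stability.* If `u_k` and `u` solve the problems for `θ_k` and `θ`, then
`θ₀² |||u_k - u|||² ≤ ∫∫ (θ_k - θ)² |𝒟*u|²` (`IsWeakSolution.norm_sq_sub_le`). The right-hand side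
tends to zero by dominated convergence, so `u_k → u` in energy, by Poincaré in `L²`, and the costs
converge. Thus a limit of a minimizing sequence is a minimizer (`exists_minimizer`). Since the
solutions converge strongly, no compact embedding of the energy space is used.

*Symmetry.* `𝒟*u · 𝒟*v` is symmetric in `(x, y)`, so `θ` may be replaced by its symmetric part
without changing the weak problem (`IsWeakSolution.symmetrize`, `symmetrize_mem_admissible`). -/

open Filter Topology

/-! ### Weak sequential compactness of bounded functions -/

/-- A uniformly bounded sequence of functions on a finite measure space has a subsequence
converging weakly in `L²`, and the limit satisfies the same bound. -/
theorem exists_subseq_weak_limit_of_bounded {X : Type*} [MeasurableSpace X]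
    [MeasurableSpace.CountablyGenerated X] {μ : Measure X} [IsFiniteMeasure μ] {K : ℝ}
    {h : ℕ → X → ℝ} (hm : ∀ k, AEStronglyMeasurable (h k) μ) (hK : ∀ k, ∀ᵐ x ∂μ, |h k x| ≤ K) :
    ∃ h' : X → ℝ, ∃ ns : ℕ → ℕ, StrictMono ns ∧ AEStronglyMeasurable h' μ ∧
      (∀ᵐ x ∂μ, |h' x| ≤ K) ∧
      ∀ ψ : X → ℝ, MemLp ψ 2 μ →
        Tendsto (fun j => ∫ x, h (ns j) x * ψ x ∂μ) atTop (𝓝 (∫ x, h' x * ψ x ∂μ)) := by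
  have hmem : ∀ k, MemLp (h k) 2 μ := fun k =>
    MemLp.of_bound (hm k) K ((hK k).mono fun x hx => by simpa using hx)
  have hinner : ∀ a ψ : X → ℝ, ∀ (ha : MemLp a 2 μ) (hψ : MemLp ψ 2 μ),
      inner ℝ (ha.toLp a) (hψ.toLp ψ) = ∫ x, a x * ψ x ∂μ := by
    intro a ψ ha hψ
    rw [L2.inner_def]
    refine integral_congr_ae ?_
    filter_upwards [ha.coeFn_toLp, hψ.coeFn_toLp] with x h1 h2
    rw [h1, h2, real_inner_eq_re_inner, RCLike.inner_apply]
    simp [mul_comm]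
  obtain ⟨R, hR⟩ : ∃ R : ℝ, ∀ k, ‖(hmem k).toLp (h k)‖ ≤ R := by
    refine ⟨(μ Set.univ).toReal ^ (1 / (2 : ℝ≥0∞).toReal) * K, fun k => ?_⟩
    have hK0 : 0 ≤ K ∨ μ = 0 := by
      by_cases hμ : μ = 0
      · exact Or.inr hμ
      · left
        have : (ae μ).NeBot := ae_neBot.2 hμ
        obtain ⟨x, hx⟩ := (hK 0).exists
        exact (abs_nonneg _).trans hx
    rcases hK0 with hK0 | h0
    · have h1 : ∀ᵐ x ∂μ, ‖(hmem k).toLp (h k) x‖ ≤ K := by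
        filter_upwards [(hmem k).coeFn_toLp, hK k] with x h1 h2
        rw [h1]; exact h2
      have := Lp.norm_le_of_ae_bound (p := 2) hK0 h1
      simpa [measureUnivNNReal, ENNReal.coe_toNNReal_eq_toReal] using this
    · subst h0
      simp
  let T : ℕ → WeakDual ℝ (Lp ℝ 2 μ) := fun k =>
    StrongDual.toWeakDual (InnerProductSpace.toDual ℝ _ ((hmem k).toLp (h k)))
  have hT : ∀ k, T k ∈ WeakDual.toStrongDual ⁻¹'
      Metric.closedBall (0 : StrongDual ℝ (Lp ℝ 2 μ)) R := by
    intro k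
    simpa [T] using hR k
  have : Fact ((2 : ℝ≥0∞) ≠ ⊤) := ⟨by norm_num⟩
  obtain ⟨L, -, ns, hns, hL⟩ :=
    WeakDual.isSeqCompact_closedBall ℝ (Lp ℝ 2 μ) 0 R hT
  obtain ⟨F, hF⟩ := (InnerProductSpace.toDual ℝ (Lp ℝ 2 μ)).surjective (WeakDual.toStrongDual L)
  have hconv : ∀ ψ : X → ℝ, MemLp ψ 2 μ →
      Tendsto (fun j => ∫ x, h (ns j) x * ψ x ∂μ) atTop (𝓝 (∫ x, F x * ψ x ∂μ)) := by
    intro ψ hψ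
    have h1 := ((WeakDual.eval_continuous (𝕜 := ℝ) (hψ.toLp ψ)).tendsto L).comp hL
    have h2 : L (hψ.toLp ψ) = ∫ x, F x * ψ x ∂μ := by
      have : L (hψ.toLp ψ) = InnerProductSpace.toDual ℝ (Lp ℝ 2 μ) F (hψ.toLp ψ) := by
        rw [hF]; rfl
      rw [this, InnerProductSpace.toDual_apply_apply, ← hinner F ψ (Lp.memLp F) hψ,
        Lp.toLp_coeFn]
    rw [h2] at h1
    refine h1.congr fun j => ?_
    exact hinner _ _ (hmem (ns j)) hψ
  have hFi : Integrable F μ := (Lp.memLp F).integrable (by norm_num)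
  have hhi : ∀ k, Integrable (h k) μ := fun k => (hmem k).integrable (by norm_num)
  -- the bound on the limit is tested on indicators
  have hset : ∀ s, MeasurableSet s →
      Tendsto (fun j => ∫ x in s, h (ns j) x ∂μ) atTop (𝓝 (∫ x in s, F x ∂μ)) := by
    intro s hs
    have := hconv (s.indicator 1) ((memLp_const (1 : ℝ)).indicator hs)
    have he : ∀ a : X → ℝ, ∫ x, a x * s.indicator 1 x ∂μ = ∫ x in s, a x ∂μ := by
      intro a
      rw [← integral_indicator hs]
      congr 1; ext x
      by_cases hx : x ∈ s <;> simp [hx]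
    simpa only [he] using this
  have hub : F ≤ᵐ[μ] fun _ => K := by
    refine ae_le_of_forall_setIntegral_le hFi (integrable_const K) fun s hs _ => ?_
    refine le_of_tendsto (hset s hs) (Eventually.of_forall fun j => ?_)
    refine setIntegral_mono_ae (hhi _).integrableOn (integrable_const K).integrableOn ?_
    filter_upwards [hK (ns j)] with x hx using (abs_le.1 hx).2
  have hlb : (fun _ => -K) ≤ᵐ[μ] F := by
    refine ae_le_of_forall_setIntegral_le (integrable_const (-K)) hFi fun s hs _ => ?_
    refine ge_of_tendsto (hset s hs) (Eventually.of_forall fun j => ?_)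
    refine setIntegral_mono_ae (integrable_const (-K)).integrableOn (hhi _).integrableOn ?_
    filter_upwards [hK (ns j)] with x hx using (abs_le.1 hx).1
  refine ⟨F, ns, hns, Lp.aestronglyMeasurable F, ?_, hconv⟩
  filter_upwards [hub, hlb] with x h1 h2 using abs_le.2 ⟨h2, h1⟩

/-! ### Functions with bounded weak gradient are locally Lipschitz -/

section WeakGradient

variable {E : Type*} [NormedAddCommGroup E] [NormedSpace ℝ E] [MeasureSpace E]

/-- The weak gradient of `θ` on `U` is bounded by `C` in `L^∞`, stated by duality against
nonnegative test functions: `|∫_U θ ∂_w φ| ≤ C ‖w‖ ∫ φ`. -/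
def WeakGradientLE (U : Set E) (θ : E → ℝ) (C : ℝ) : Prop :=
  ∀ φ : E → ℝ, ContDiff ℝ ∞ φ → HasCompactSupport φ → tsupport φ ⊆ U → (∀ x, 0 ≤ φ x) →
    ∀ w : E, |∫ p in U, θ p * fderiv ℝ φ p w| ≤ C * ‖w‖ * ∫ p, φ p

variable [FiniteDimensional ℝ E] [BorelSpace E] [(volume : Measure E).IsAddHaarMeasure]

/-- Mollifications of `θ` have gradient bounded by `C` at distance more than the mollification
radius from the complement of `U`. -/
theorem WeakGradientLE.norm_fderiv_convolution_le {U : Set E} {θ : E → ℝ} {C : ℝ}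
    (hU : IsOpen U) (hC : 0 ≤ C) (hθ : IntegrableOn θ U)
    (h : WeakGradientLE U θ C) (φ : ContDiffBump (0 : E)) {p : E}
    (hp : Metric.closedBall p φ.rOut ⊆ U) :
    ‖(convolution (fderiv ℝ (φ.normed volume)) (U.indicator θ)
      (ContinuousLinearMap.precompL E (ContinuousLinearMap.lsmul ℝ ℝ)) volume p : E →L[ℝ] ℝ)‖
      ≤ C := by
  have hsm : ContDiff ℝ ∞ (φ.normed volume) := φ.contDiff_normed
  refine ContinuousLinearMap.opNorm_le_bound _ hC fun w => ?_
  have hex : ConvolutionExistsAt (fderiv ℝ (φ.normed volume)) (U.indicator θ) p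
      (ContinuousLinearMap.precompL E (ContinuousLinearMap.lsmul ℝ ℝ)) volume :=
    (φ.hasCompactSupport_normed.fderiv (𝕜 := ℝ)).convolutionExists_left _
      (hsm.continuous_fderiv (by simp))
      ((integrable_indicator_iff hU.measurableSet).2 hθ).locallyIntegrable p
  rw [convolution_eq_swap, ContinuousLinearMap.integral_apply hex.integrable_swap]
  -- the test function is the reflected and translated kernel
  set χ : E → ℝ := fun t => φ.normed volume (p - t) with hχ
  have hχd : ∀ t w, fderiv ℝ χ t w = -fderiv ℝ (φ.normed volume) (p - t) w := by
    intro t w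
    have h1 : HasFDerivAt χ ((fderiv ℝ (φ.normed volume) (p - t)).comp
        (-ContinuousLinearMap.id ℝ E)) t := by
      have h2 := ((hsm.differentiable (by simp)) (p - t)).hasFDerivAt
      exact h2.comp t ((hasFDerivAt_id t).const_sub p)
    rw [h1.fderiv]; simp
  have hχs : tsupport χ ⊆ Metric.closedBall p φ.rOut := by
    refine closure_minimal (fun t ht => ?_) Metric.isClosed_closedBall
    have : p - t ∈ Function.support (φ.normed volume) := ht
    rw [φ.support_normed_eq, mem_ball_zero_iff] at this
    rw [Metric.mem_closedBall, dist_comm, dist_eq_norm]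
    exact this.le
  have hχ1 : ∫ t, χ t = 1 := by
    rw [hχ, integral_sub_left_eq_self (fun t => φ.normed volume t) volume p]
    exact φ.integral_normed
  have key := h χ (hsm.comp (contDiff_const.sub contDiff_id))
    ((isCompact_closedBall p φ.rOut).of_isClosed_subset (isClosed_tsupport χ) hχs)
    (hχs.trans hp) (fun x => φ.nonneg_normed _) w
  rw [hχ1, mul_one] at key
  refine le_trans (le_of_eq ?_) key
  rw [Real.norm_eq_abs, ← abs_neg, ← integral_neg, ← integral_indicator hU.measurableSet]
  congr 2
  ext t
  by_cases ht : t ∈ U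
  · simp [ht, hχd, ContinuousLinearMap.precompL_apply, mul_comm]
  · simp [ht]

/-- A function with weak gradient bounded by `C` is `C`-Lipschitz on balls inside `U`, up to null
sets: its mollifications are `C`-Lipschitz by the mean value inequality and converge to it almost
everywhere. -/
theorem WeakGradientLE.ae_lipschitz {U : Set E} {θ : E → ℝ} {C : ℝ}
    (hU : IsOpen U) (hC : 0 ≤ C) (hθ : IntegrableOn θ U) (h : WeakGradientLE U θ C) :
    ∀ᵐ p : E, ∀ δ : ℝ, Metric.ball p δ ⊆ U →
      ∀ᵐ q : E, q ∈ Metric.ball p δ → |θ q - θ p| ≤ C * δ := by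
  let φ : ℕ → ContDiffBump (0 : E) := fun i =>
    ⟨1 / ((i : ℝ) + 1), 2 * (1 / ((i : ℝ) + 1)), by positivity,
      by have : (0 : ℝ) < 1 / ((i : ℝ) + 1) := by positivity
         linarith⟩
  have hφ0 : Tendsto (fun i => (φ i).rOut) atTop (𝓝 0) := by
    simpa [φ] using (tendsto_one_div_add_atTop_nhds_zero_nat (𝕜 := ℝ)).const_mul 2
  have hloc : LocallyIntegrable (U.indicator θ) :=
    ((integrable_indicator_iff hU.measurableSet).2 hθ).locallyIntegrable
  have hae := ContDiffBump.ae_convolution_tendsto_right_of_locallyIntegrable (μ := volume)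
    (K := 2) hφ0 (Eventually.of_forall fun i => le_rfl) hloc
  filter_upwards [hae] with p hp δ hδ
  filter_upwards [hae] with q hq hqB
  have hδ0 : 0 < δ := (dist_nonneg).trans_lt hqB
  have hpU : p ∈ U := hδ (Metric.mem_ball_self hδ0)
  have hqU : q ∈ U := hδ hqB
  rw [Set.indicator_of_mem hpU] at hp
  rw [Set.indicator_of_mem hqU] at hq
  refine le_of_tendsto (hq.sub hp).abs ?_
  have hr : 0 < (δ - dist q p) / 2 := by rw [Metric.mem_ball] at hqB; linarith
  filter_upwards [hφ0.eventually_lt_const hr] with i hi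
  have hsub : ∀ x ∈ Metric.ball p (dist q p + (δ - dist q p) / 2),
      Metric.closedBall x (φ i).rOut ⊆ U := by
    intro x hx y hy
    apply hδ
    rw [Metric.mem_ball] at hx ⊢
    rw [Metric.mem_closedBall] at hy
    linarith [dist_triangle y x p]
  have hmv := Convex.norm_image_sub_le_of_norm_hasFDerivWithin_le
    (f := convolution ((φ i).normed volume) (U.indicator θ) (ContinuousLinearMap.lsmul ℝ ℝ) volume)
    (x := p) (y := q) (C := C)
    (fun x _ => (HasCompactSupport.hasFDerivAt_convolution_left (ContinuousLinearMap.lsmul ℝ ℝ)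
      (φ i).hasCompactSupport_normed (φ i).contDiff_normed hloc x).hasFDerivWithinAt)
    (fun x hx => h.norm_fderiv_convolution_le hU hC hθ (φ i) (hsub x hx))
    (convex_ball p (dist q p + (δ - dist q p) / 2))
    (Metric.mem_ball_self (by linarith [dist_nonneg (x := q) (y := p)]))
    (by rw [Metric.mem_ball]; linarith)
  refine hmv.trans (mul_le_mul_of_nonneg_left ?_ hC)
  rw [← dist_eq_norm]
  exact (Metric.mem_ball.1 hqB).le

/-- Under a common bound on the weak gradients, weak convergence implies convergence almost
everywhere. Weak convergence gives convergence of the averages over small balls, and functions with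
a common Lipschitz bound are uniformly close to these averages. -/
theorem tendsto_ae_of_weak_of_weakGradientLE {U : Set E} (hU : IsOpen U)
    (hUfin : volume U ≠ ⊤) {C : ℝ} (hC : 0 ≤ C) {h : ℕ → E → ℝ} {h' : E → ℝ}
    (hi : ∀ k, IntegrableOn (h k) U) (hi' : IntegrableOn h' U)
    (hg : ∀ k, WeakGradientLE U (h k) C)
    (hconv : ∀ ψ : E → ℝ, MemLp ψ 2 (volume.restrict U) →
      Tendsto (fun j => ∫ x in U, h j x * ψ x) atTop (𝓝 (∫ x in U, h' x * ψ x))) :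
    ∀ᵐ p ∂(volume.restrict U), Tendsto (fun j => h j p) atTop (𝓝 (h' p)) := by
  have : IsFiniteMeasure (volume.restrict U) := ⟨by simpa using hUfin.lt_top⟩
  have hg' : WeakGradientLE U h' C := by
    intro φ h1 h2 h3 h4 w
    have hψ : MemLp (fun p => fderiv ℝ φ p w) 2 (volume.restrict U) := by
      refine (Continuous.memLp_of_hasCompactSupport ?_ ?_ : MemLp _ 2 volume).restrict U
      · exact (h1.continuous_fderiv (by simp)).clm_apply continuous_const
      · exact h2.fderiv_apply (𝕜 := ℝ) w
    exact le_of_tendsto (hconv _ hψ).abs (Eventually.of_forall fun j => hg j φ h1 h2 h3 h4 w)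
  have hl := ae_all_iff.2 fun k => (hg k).ae_lipschitz hU hC (hi k)
  have hl' := hg'.ae_lipschitz hU hC hi'
  rw [ae_restrict_iff' hU.measurableSet]
  filter_upwards [hl, hl'] with p hp hp' hpU
  obtain ⟨R, hR, hRU⟩ := Metric.isOpen_iff.1 hU p hpU
  rw [Metric.tendsto_atTop']
  intro η hη
  obtain ⟨δ, hδ0, hδR, hδ⟩ : ∃ δ, 0 < δ ∧ δ ≤ R ∧ C * δ < η / 4 := by
    refine ⟨min R (η / (8 * (C + 1))), by positivity, min_le_left _ _, ?_⟩
    calc C * min R (η / (8 * (C + 1))) ≤ C * (η / (8 * (C + 1))) :=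
          mul_le_mul_of_nonneg_left (min_le_right _ _) hC
      _ ≤ (C + 1) * (η / (8 * (C + 1))) := by gcongr; linarith
      _ = η / 8 := by field_simp
      _ < η / 4 := by linarith
  have hBU : Metric.ball p δ ⊆ U := (Metric.ball_subset_ball hδR).trans hRU
  set m := volume.real (Metric.ball p δ) with hm
  have hm0 : 0 < m :=
    ENNReal.toReal_pos (Metric.measure_ball_pos _ _ hδ0).ne' measure_ball_lt_top.ne
  have hav : ∀ a : E → ℝ, IntegrableOn a U →
      (∀ᵐ q : E, q ∈ Metric.ball p δ → |a q - a p| ≤ C * δ) →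
      |(∫ q in Metric.ball p δ, a q) - m * a p| ≤ C * δ * m := by
    intro a ha hb
    have h1 : (∫ q in Metric.ball p δ, a q) - m * a p = ∫ q in Metric.ball p δ, (a q - a p) := by
      rw [integral_sub (ha.mono_set hBU) (integrableOn_const measure_ball_lt_top.ne)]
      simp [hm]
    rw [h1]
    exact norm_setIntegral_le_of_norm_le_const_ae' (f := fun q => a q - a p)
      measure_ball_lt_top hb
  have hball : ∀ a : E → ℝ, ∫ x in U, a x * (Metric.ball p δ).indicator 1 x
      = ∫ q in Metric.ball p δ, a q := by
    intro a
    have : (fun x => a x * (Metric.ball p δ).indicator 1 x) = (Metric.ball p δ).indicator a := by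
      ext x; by_cases hx : x ∈ Metric.ball p δ <;> simp [hx]
    rw [this, setIntegral_indicator measurableSet_ball, Set.inter_eq_right.2 hBU]
  have hlim := hconv ((Metric.ball p δ).indicator 1)
    ((memLp_const (1 : ℝ)).indicator measurableSet_ball)
  simp only [hball] at hlim
  obtain ⟨N, hN⟩ := Metric.tendsto_atTop'.1 hlim (η / 4 * m) (by positivity)
  refine ⟨N, fun k hk => ?_⟩
  have e1 := hav (h k) (hi k) (hp k δ hBU)
  have e2 := hav h' hi' (hp' δ hBU)
  have e3 := hN k hk
  rw [Real.dist_eq] at e3 ⊢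
  have e4 : C * δ * m ≤ η / 4 * m := by gcongr
  have e5 : |m * (h k p - h' p)| < m * η := by
    rw [abs_lt]
    constructor <;>
    nlinarith [abs_le.1 e1, abs_le.1 e2, abs_lt.1 e3, mul_pos hη hm0]
  rw [abs_mul, abs_of_pos hm0] at e5
  exact lt_of_mul_lt_mul_left e5 hm0.le

end WeakGradient

namespace NonlocalControl

variable {n : ℕ}

/-! ### Compactness in `W^{1,∞}` for almost everywhere convergence -/

/-- Instance search does not unfold the volume of a product to a product measure. -/
instance isAddHaarMeasure_volume_prod :
    (volume : Measure (Rn n × Rn n)).IsAddHaarMeasure :=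
  inferInstanceAs ((volume : Measure (Rn n)).prod (volume : Measure (Rn n))).IsAddHaarMeasure

/-- The bound is `max K 0` because `ENNReal.ofReal` sends negative `K` to `0`. -/
theorem ae_abs_le_of_eLpNorm_top_le {X : Type*} [MeasurableSpace X] {μ : Measure X} {g : X → ℝ}
    {K : ℝ} (h : eLpNorm g ∞ μ ≤ ENNReal.ofReal K) : ∀ᵐ x ∂μ, |g x| ≤ max K 0 := by
  rw [eLpNorm_exponent_top] at h
  filter_upwards [ae_le_eLpNormEssSup (f := g) (μ := μ)] with x hx
  have := hx.trans h
  rw [← ofReal_norm] at this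
  have h2 := ENNReal.toReal_mono ENNReal.ofReal_ne_top this
  rwa [ENNReal.toReal_ofReal (norm_nonneg _), ENNReal.toReal_ofReal'] at h2

theorem eLpNorm_top_le_of_ae_abs_le {X : Type*} [MeasurableSpace X] {μ : Measure X} {g : X → ℝ}
    {K : ℝ} (h : ∀ᵐ x ∂μ, |g x| ≤ max K 0) : eLpNorm g ∞ μ ≤ ENNReal.ofReal K := by
  rw [eLpNorm_exponent_top]
  refine eLpNormEssSup_le_of_ae_enorm_bound ?_
  filter_upwards [h] with x hx
  rw [← ofReal_norm]
  refine (ENNReal.ofReal_le_ofReal hx).trans ?_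
  rcases le_total K 0 with hK | hK <;> simp [hK]

theorem exists_coeff_coordDir (w : Rn n × Rn n) :
    ∃ c : Fin n ⊕ Fin n → ℝ, w = ∑ k, c k • coordDir k ∧ ∀ k, |c k| ≤ ‖w‖ := by
  have hs : ∀ a : Rn n, ∑ i, a i • EuclideanSpace.single i (1 : ℝ) = a := fun a => by
    simpa using (EuclideanSpace.basisFun (Fin n) ℝ).sum_repr a
  refine ⟨Sum.elim (fun i => w.1 i) (fun i => w.2 i), ?_, ?_⟩
  · ext1
    · simp [coordDir, Prod.fst_sum, hs]
    · simp [coordDir, Prod.snd_sum, hs]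
  · rintro (i | i)
    · exact (PiLp.norm_apply_le w.1 i).trans (norm_fst_le w)
    · exact (PiLp.norm_apply_le w.2 i).trans (norm_snd_le w)

theorem memLp_of_test {U : Set (Rn n × Rn n)} {φ : Rn n × Rn n → ℝ} (h1 : ContDiff ℝ ∞ φ)
    (h2 : HasCompactSupport φ) : MemLp φ 2 (volume.restrict U) :=
  (h1.continuous.memLp_of_hasCompactSupport h2 : MemLp _ 2 volume).restrict U

theorem memLp_fderiv_of_test {U : Set (Rn n × Rn n)} {φ : Rn n × Rn n → ℝ} (h1 : ContDiff ℝ ∞ φ)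
    (h2 : HasCompactSupport φ) (w : Rn n × Rn n) :
    MemLp (fun p => fderiv ℝ φ p w) 2 (volume.restrict U) :=
  (Continuous.memLp_of_hasCompactSupport
    ((h1.continuous_fderiv (by simp)).clm_apply continuous_const)
    (h2.fderiv_apply (𝕜 := ℝ) w) : MemLp _ 2 volume).restrict U

/-- Bounds on the `2n` weak partial derivatives bound the weak derivative in every direction. -/
theorem W1InftyNormLE.weakGradientLE {U : Set (Rn n × Rn n)} (hUfin : volume U ≠ ⊤)
    {θ : Rn n × Rn n → ℝ} {K : ℝ} (h : W1InftyNormLE U θ K) :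
    WeakGradientLE U θ (Fintype.card (Fin n ⊕ Fin n) * max K 0) := by
  have : IsFiniteMeasure (volume.restrict U) := ⟨by simpa using hUfin.lt_top⟩
  obtain ⟨hθ, -, hg⟩ := h
  choose g hgm hgd hgK using hg
  intro φ h1 h2 h3 h4 w
  obtain ⟨c, hc, hcw⟩ := exists_coeff_coordDir w
  have hθ2 : MemLp θ 2 (volume.restrict U) := hθ.mono_exponent le_top
  have e1 : ∫ p in U, θ p * fderiv ℝ φ p w
      = ∑ k, c k * ∫ p in U, θ p * fderiv ℝ φ p (coordDir k) := by
    simp_rw [← integral_const_mul]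
    rw [← integral_finsetSum]
    · refine integral_congr_ae (Eventually.of_forall fun p => ?_)
      simp only
      conv_lhs => rw [hc]
      rw [map_sum, Finset.mul_sum]
      refine Finset.sum_congr rfl fun k _ => ?_
      rw [map_smul, smul_eq_mul]; ring
    · intro k _
      exact (hθ2.integrable_mul (memLp_fderiv_of_test h1 h2 _)).const_mul _
  have e2 : ∀ k, |c k * ∫ p in U, θ p * fderiv ℝ φ p (coordDir k)|
      ≤ max K 0 * ‖w‖ * ∫ p, φ p := by
    intro k
    have hφi : Integrable φ := h1.continuous.integrable_of_hasCompactSupport h2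
    have hφ0 : 0 ≤ ∫ p, φ p := integral_nonneg h4
    rw [hgd k φ h1 h2 h3, abs_mul, abs_neg]
    have e3 : |∫ p in U, g k p * φ p| ≤ max K 0 * ∫ p, φ p := by
      calc |∫ p in U, g k p * φ p| ≤ ∫ p in U, max K 0 * φ p := by
            rw [← Real.norm_eq_abs]
            refine norm_integral_le_of_norm_le (hφi.restrict.const_mul _) ?_
            filter_upwards [ae_abs_le_of_eLpNorm_top_le (hgK k)] with p hp
            rw [norm_mul, Real.norm_eq_abs, Real.norm_eq_abs, abs_of_nonneg (h4 p)]
            exact mul_le_mul_of_nonneg_right hp (h4 p)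
        _ = max K 0 * ∫ p in U, φ p := integral_const_mul _ _
        _ ≤ max K 0 * ∫ p, φ p := by
            refine mul_le_mul_of_nonneg_left ?_ (le_max_right _ _)
            exact setIntegral_le_integral hφi (Eventually.of_forall h4)
    calc |c k| * |∫ p in U, g k p * φ p| ≤ ‖w‖ * (max K 0 * ∫ p, φ p) :=
          mul_le_mul (hcw k) e3 (abs_nonneg _) (norm_nonneg _)
      _ = _ := by ring
  rw [e1]
  refine (Finset.abs_sum_le_sum_abs _ _).trans ?_
  refine (Finset.sum_le_sum fun k _ => e2 k).trans (le_of_eq ?_)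
  rw [Finset.sum_const, nsmul_eq_mul, Finset.card_univ]; ring

/-- Sequential compactness of balls of `W^{1,∞}(U)` for almost everywhere convergence. No
regularity of `∂U` is needed, since only interior balls are compared. -/
theorem exists_subseq_tendsto_ae_of_W1InftyNormLE {U : Set (Rn n × Rn n)} (hU : IsOpen U)
    (hUfin : volume U ≠ ⊤) {K : ℝ} {θ : ℕ → Rn n × Rn n → ℝ}
    (hθ : ∀ k, W1InftyNormLE U (θ k) K) :
    ∃ θ' : Rn n × Rn n → ℝ, ∃ ns : ℕ → ℕ, StrictMono ns ∧ W1InftyNormLE U θ' K ∧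
      ∀ᵐ p ∂(volume.restrict U), Tendsto (fun j => θ (ns j) p) atTop (𝓝 (θ' p)) := by
  have : IsFiniteMeasure (volume.restrict U) := ⟨by simpa using hUfin.lt_top⟩
  have hθK := fun k => ae_abs_le_of_eLpNorm_top_le (hθ k).2.1
  obtain ⟨θ', ns, hns, hm', hK', hconv⟩ :=
    exists_subseq_weak_limit_of_bounded (fun k => (hθ k).1.aestronglyMeasurable) hθK
  refine ⟨θ', ns, hns, ⟨memLp_top_of_bound hm' _ hK', eLpNorm_top_le_of_ae_abs_le hK', ?_⟩, ?_⟩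
  -- each partial derivative has its own weakly convergent subsequence; the limit of the functions
  -- is already fixed, so these subsequences need not agree
  · intro k
    choose g hgm hgd hgK using fun j => (hθ (ns j)).2.2 k
    obtain ⟨g', ms, hms, hgm', hgK', hgconv⟩ :=
      exists_subseq_weak_limit_of_bounded (fun j => (hgm j).aestronglyMeasurable)
        (fun j => ae_abs_le_of_eLpNorm_top_le (hgK j))
    refine ⟨g', memLp_top_of_bound hgm' _ hgK', fun φ h1 h2 h3 => ?_,
      eLpNorm_top_le_of_ae_abs_le hgK'⟩
    have l1 := (hconv _ (memLp_fderiv_of_test h1 h2 (coordDir k))).comp hms.tendsto_atTop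
    have l2 := (hgconv φ (memLp_of_test h1 h2)).neg
    refine tendsto_nhds_unique l1 (l2.congr fun j => ?_)
    exact (hgd (ms j) φ h1 h2 h3).symm
  · refine tendsto_ae_of_weak_of_weakGradientLE hU hUfin (by positivity)
      (fun j => (hθ (ns j)).1.integrable le_top)
      ((memLp_top_of_bound hm' _ hK').integrable le_top)
      (fun j => (hθ (ns j)).weakGradientLE hUfin) hconv

/-! ### The domain and the nonlocal Poincaré inequality -/

variable {Ω : Set (Rn n)} {α : Rn n → Rn n → Rn n} {ε γ₀ : ℝ}

theorem norm_sq_nonlocalAdj (α : Rn n → Rn n → Rn n) (v : Rn n → ℝ) (x y : Rn n) :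
    ‖nonlocalAdj α v x y‖ ^ 2 = (v y - v x) ^ 2 * kernel α x y := by
  rw [nonlocalAdj, norm_neg, norm_smul, mul_pow, kernel, real_inner_self_eq_norm_sq]
  simp

/-- `D` is the open `ε`-neighbourhood of `Ω`. The kernel conditions only give distance at most `ε`
on `Ω_I`; the inequality becomes strict because `Ω` is open. -/
theorem totalDomain_eq_thickening (hΩ : IsOpen Ω) (hα : KernelConditions Ω α ε γ₀) (hε : 0 < ε) :
    totalDomain Ω α = Metric.thickening ε Ω := by
  ext y
  rw [Metric.mem_thickening_iff]
  constructor
  · rintro (hy | ⟨hy, x, hx, hxy⟩)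
    · exact ⟨y, hy, by simpa using hε⟩
    · have hle : ‖y - x‖ ≤ ε := by
        by_contra hcon
        have := hα.vanishes x (Or.inl hx) y (Or.inr ⟨hy, x, hx, hxy⟩) (not_le.1 hcon)
        exact hxy (inner_self_eq_zero.1 this)
      have hne : 0 < ‖y - x‖ := norm_pos_iff.2 (sub_ne_zero.2 fun h => hy (h ▸ hx))
      -- moving `x` slightly towards `y` makes the inequality strict
      obtain ⟨r, hr, hball⟩ := Metric.isOpen_iff.1 hΩ x hx
      obtain ⟨t, ht0, ht1, htr⟩ : ∃ t : ℝ, 0 < t ∧ t ≤ 1 ∧ t * ‖y - x‖ < r := by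
        refine ⟨min 1 (r / (2 * ‖y - x‖)), by positivity, min_le_left _ _, ?_⟩
        calc min 1 (r / (2 * ‖y - x‖)) * ‖y - x‖ ≤ r / (2 * ‖y - x‖) * ‖y - x‖ := by
              gcongr; exact min_le_right _ _
          _ = r / 2 := by field_simp
          _ < r := by linarith
      refine ⟨x + t • (y - x), hball ?_, ?_⟩
      · rw [mem_ball_iff_norm]
        simpa [norm_smul, abs_of_pos ht0] using htr
      · have : y - (x + t • (y - x)) = (1 - t) • (y - x) := by module
        rw [dist_eq_norm, this, norm_smul, Real.norm_eq_abs, abs_of_nonneg (by linarith)]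
        nlinarith
  · rintro ⟨x, hx, hxy⟩
    by_cases hy : y ∈ Ω
    · exact Or.inl hy
    · exact Or.inr ⟨hy, x, hx, hα.interacts x hx y hy (by rwa [← dist_eq_norm])⟩

theorem isOpen_totalDomain (hΩ : IsOpen Ω) (hα : KernelConditions Ω α ε γ₀) (hε : 0 < ε) :
    IsOpen (totalDomain Ω α) := by
  rw [totalDomain_eq_thickening hΩ hα hε]; exact Metric.isOpen_thickening

theorem interactionDomain_eq_diff : interactionDomain Ω α = totalDomain Ω α \ Ω := by
  ext y
  constructor
  · exact fun h => ⟨Or.inr h, h.1⟩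
  · rintro ⟨h | h, h'⟩
    · exact absurd h h'
    · exact h

theorem volume_restrict_pairDomain (Ω : Set (Rn n)) (α : Rn n → Rn n → Rn n) :
    (volume : Measure (Rn n × Rn n)).restrict (pairDomain Ω α) =
      ((volume : Measure (Rn n)).restrict (totalDomain Ω α)).prod
        ((volume : Measure (Rn n)).restrict (totalDomain Ω α)) := by
  rw [Measure.prod_restrict]; rfl

/-- Almost everywhere statements on `D` hold for both components almost everywhere on `D × D`. -/
theorem ae_pairDomain_of_ae {P : Rn n → Prop}
    (h : ∀ᵐ x ∂(volume.restrict (totalDomain Ω α)), P x) :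
    ∀ᵐ p ∂(volume.restrict (pairDomain Ω α)), P p.1 ∧ P p.2 := by
  rw [volume_restrict_pairDomain]
  exact (Measure.quasiMeasurePreserving_fst.ae h).and (Measure.quasiMeasurePreserving_snd.ae h)

theorem nonlocalAdj_congr_ae {v w : Rn n → ℝ}
    (h : v =ᵐ[volume.restrict (totalDomain Ω α)] w) :
    (fun p : Rn n × Rn n => nonlocalAdj α v p.1 p.2) =ᵐ[volume.restrict (pairDomain Ω α)]
      fun p => nonlocalAdj α w p.1 p.2 := by
  filter_upwards [ae_pairDomain_of_ae h] with p hp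
  simp only [nonlocalAdj, hp.1, hp.2]

theorem eLpNorm_translate_nsmul_sub_le {w : Rn n → ℝ} (hw : AEStronglyMeasurable w volume)
    (h : Rn n) (N : ℕ) :
    eLpNorm (fun x => w (x + N • h) - w x) 2 volume ≤
      N * eLpNorm (fun x => w (x + h) - w x) 2 volume := by
  have hmp : ∀ a : Rn n, MeasurePreserving (fun x => x + a) (volume : Measure (Rn n)) volume :=
    fun a => measurePreserving_add_right volume a
  have hwm : ∀ a : Rn n, AEStronglyMeasurable (fun x => w (x + a)) volume :=
    fun a => hw.comp_measurePreserving (hmp a)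
  induction N with
  | zero => simp
  | succ N ih =>
    have e : (fun x => w (x + (N + 1) • h) - w x) =
        (fun x => w (x + N • h + h) - w (x + N • h)) + fun x => w (x + N • h) - w x := by
      ext x
      simp only [Pi.add_apply]
      rw [succ_nsmul, ← add_assoc]; ring
    have hst : eLpNorm (fun x => w (x + N • h + h) - w (x + N • h)) 2 volume
        = eLpNorm (fun x => w (x + h) - w x) 2 volume :=
      eLpNorm_comp_measurePreserving (g := fun x => w (x + h) - w x) ((hwm h).sub hw) (hmp (N • h))
    rw [e]
    refine (eLpNorm_add_le ?_ ?_ (by norm_num)).trans ?_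
    · exact ((hwm h).sub hw).comp_measurePreserving (hmp (N • h))
    · exact (hwm _).sub hw
    · rw [hst]
      push_cast
      rw [add_mul, one_mul, add_comm]
      gcongr

/-- If `Ω` is bounded, then `N` steps of length at least `a` lead out of `Ω`. -/
theorem exists_nsmul_add_notMem (hΩ : Bornology.IsBounded Ω) {a : ℝ} (ha : 0 < a) :
    ∃ N : ℕ, ∀ x ∈ Ω, ∀ h : Rn n, a < ‖h‖ → x + N • h ∉ Ω := by
  obtain ⟨R, hR⟩ := hΩ.exists_norm_le
  obtain ⟨N, hN⟩ := exists_nat_gt (2 * R / a)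
  refine ⟨N, fun x hx h hh hmem => ?_⟩
  have h1 := hR _ hx
  have h2 := hR _ hmem
  have h3 : ‖N • h‖ ≤ 2 * R := by
    calc ‖N • h‖ = ‖(x + N • h) - x‖ := by simp
      _ ≤ R + R := (norm_sub_le _ _).trans (add_le_add h2 h1)
      _ = 2 * R := by ring
  rw [← Nat.cast_smul_eq_nsmul ℝ, norm_smul] at h3
  rw [div_lt_iff₀ ha] at hN
  have : (N : ℝ) * a ≤ N * ‖h‖ := by gcongr
  simp at h3
  linarith

theorem eLpNorm_two_sq {X F : Type*} [MeasurableSpace X] {μ : Measure X} [NormedAddCommGroup F]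
    (f : X → F) : eLpNorm f 2 μ ^ 2 = ∫⁻ x, ‖f x‖ₑ ^ 2 ∂μ := by
  simpa using eLpNorm_nnreal_pow_eq_lintegral (f := f) (μ := μ) (p := 2) (by norm_num)

theorem enorm_sq_eq_ofReal {F : Type*} [NormedAddCommGroup F] (z : F) :
    ‖z‖ₑ ^ 2 = ENNReal.ofReal (‖z‖ ^ 2) := by
  rw [← ofReal_norm, ENNReal.ofReal_pow (norm_nonneg _)]

/-- The nonlocal Poincaré inequality on `V_c`, for squared norms. Extend `v` by zero outside `Ω`.
A bounded number `N` of steps `h` with `ε / 4 < ‖h‖ < ε / 2` leads out of `Ω`, so telescoping gives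
`‖v‖ ≤ N ‖v(· + h) - v‖` in `L²`. Averaging the squares over `h` in a ball gives an integral over
pairs at distance less than `ε / 2`, where the kernel is at least `γ₀`. -/
theorem exists_poincare (hn : 0 < n) (hΩ : IsOpen Ω) (hΩb : Bornology.IsBounded Ω)
    (hε : 0 < ε) (hγ₀ : 0 < γ₀) (hα : KernelConditions Ω α ε γ₀) :
    ∃ C : ℝ≥0∞, C ≠ ⊤ ∧ ∀ v ∈ constrainedSpace Ω α,
      ∫⁻ x in totalDomain Ω α, ‖v x‖ₑ ^ 2 ≤
        C * ∫⁻ p in pairDomain Ω α, ‖nonlocalAdj α v p.1 p.2‖ₑ ^ 2 := by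
  obtain ⟨N, hN⟩ := exists_nsmul_add_notMem hΩb (show 0 < ε / 4 by positivity)
  -- all steps `h` in the ball `A` satisfy `ε / 4 < ‖h‖ < ε / 2`
  set A : Set (Rn n) := Metric.ball (EuclideanSpace.single ⟨0, hn⟩ (3 * ε / 8)) (ε / 8) with hA
  have hAn : ∀ h ∈ A, ε / 4 < ‖h‖ ∧ ‖h‖ < ε / 2 := by
    intro h hh
    rw [hA, mem_ball_iff_norm] at hh
    have h1 : ‖(EuclideanSpace.single ⟨0, hn⟩ (3 * ε / 8) : Rn n)‖ = 3 * ε / 8 := by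
      rw [PiLp.norm_single, Real.norm_eq_abs, abs_of_pos (by positivity)]
    have h2 := abs_norm_sub_norm_le h (EuclideanSpace.single ⟨0, hn⟩ (3 * ε / 8) : Rn n)
    rw [h1, abs_le] at h2
    constructor <;> linarith
  have hA0 : volume A ≠ 0 := (Metric.measure_ball_pos _ _ (by positivity)).ne'
  have hAt : volume A ≠ ⊤ := measure_ball_lt_top.ne
  have hAm : MeasurableSet A := measurableSet_ball
  clear_value A
  have hγ : ENNReal.ofReal γ₀ ≠ 0 := by simpa using hγ₀
  refine ⟨(volume A)⁻¹ * ((N : ℝ≥0∞) ^ 2 * (ENNReal.ofReal γ₀)⁻¹), ?_, ?_⟩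
  · refine ENNReal.mul_ne_top (by simpa using hA0) (ENNReal.mul_ne_top (by simp) ?_)
    simpa using hγ₀
  rintro v ⟨⟨hv, -⟩, hv0⟩
  have hDo := isOpen_totalDomain hΩ hα hε
  have hΩD : Ω ⊆ totalDomain Ω α := Set.subset_union_left
  -- `w` is the extension of `v` by zero
  set w : Rn n → ℝ := Ω.indicator v with hw
  have hwm : AEStronglyMeasurable w volume :=
    (aestronglyMeasurable_indicator_iff hΩ.measurableSet).2
      (hv.aestronglyMeasurable.mono_measure (Measure.restrict_mono hΩD le_rfl))
  have hvw : v =ᵐ[volume.restrict (totalDomain Ω α)] w := by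
    rw [interactionDomain_eq_diff,
      ae_restrict_iff' (hDo.measurableSet.diff hΩ.measurableSet)] at hv0
    rw [EventuallyEq, ae_restrict_iff' hDo.measurableSet]
    filter_upwards [hv0] with x hx hxD
    by_cases hxΩ : x ∈ Ω
    · simp [hw, hxΩ]
    · simp [hw, hxΩ, hx ⟨hxD, hxΩ⟩]
  have step : ∀ h ∈ A, ∫⁻ x, ‖w x‖ₑ ^ 2 ≤ (N : ℝ≥0∞) ^ 2 * ∫⁻ x, ‖w (x + h) - w x‖ₑ ^ 2 := by
    intro h hh
    rw [← eLpNorm_two_sq, ← eLpNorm_two_sq, ← mul_pow]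
    gcongr
    refine le_trans (eLpNorm_mono fun x => ?_) (eLpNorm_translate_nsmul_sub_le hwm h N)
    by_cases hx : x ∈ Ω
    · have : w (x + N • h) = 0 := Set.indicator_of_notMem (hN x hx h (hAn h hh).1) _
      simp [this]
    · simp [hw, hx]
  have hL : ∫⁻ x in totalDomain Ω α, ‖v x‖ₑ ^ 2 ≤ ∫⁻ x, ‖w x‖ₑ ^ 2 := by
    rw [lintegral_congr_ae (g := fun x => ‖w x‖ₑ ^ 2) (by filter_upwards [hvw] with x hx; rw [hx])]
    exact setLIntegral_le_lintegral _ _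
  have hR : ∫⁻ p in pairDomain Ω α, ‖nonlocalAdj α v p.1 p.2‖ₑ ^ 2 =
      ∫⁻ p in pairDomain Ω α, ‖nonlocalAdj α w p.1 p.2‖ₑ ^ 2 := by
    refine lintegral_congr_ae ?_
    filter_upwards [nonlocalAdj_congr_ae hvw] with p hp
    rw [hp]
  -- integrate `step` over `A` and substitute `y = x + h`
  set G : Rn n × Rn n → ℝ≥0∞ := fun p => A.indicator 1 (p.2 - p.1) * ‖w p.2 - w p.1‖ₑ ^ 2 with hG
  have hGm : AEMeasurable G (volume.prod volume) := by
    refine AEMeasurable.mul ?_ ?_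
    · exact ((measurable_one.indicator hAm).comp
        (measurable_snd.sub measurable_fst)).aemeasurable
    · exact (((hwm.comp_quasiMeasurePreserving Measure.quasiMeasurePreserving_snd).sub
        (hwm.comp_quasiMeasurePreserving Measure.quasiMeasurePreserving_fst)).enorm).pow_const 2
  have hmp := measurePreserving_prod_add (volume : Measure (Rn n)) (volume : Measure (Rn n))
  have key : volume A * ∫⁻ x, ‖w x‖ₑ ^ 2 ≤ (N : ℝ≥0∞) ^ 2 * ∫⁻ p, G p ∂(volume.prod volume) := by
    calc volume A * ∫⁻ x, ‖w x‖ₑ ^ 2 = ∫⁻ h in A, ∫⁻ x, ‖w x‖ₑ ^ 2 := by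
          rw [setLIntegral_const, mul_comm]
      _ ≤ ∫⁻ h in A, (N : ℝ≥0∞) ^ 2 * ∫⁻ x, ‖w (x + h) - w x‖ₑ ^ 2 :=
          setLIntegral_mono' hAm step
      _ = (N : ℝ≥0∞) ^ 2 * ∫⁻ h in A, ∫⁻ x, ‖w (x + h) - w x‖ₑ ^ 2 :=
          lintegral_const_mul' _ _ (by simp)
      _ = (N : ℝ≥0∞) ^ 2 * ∫⁻ h, ∫⁻ x, G (x, x + h) := by
          congr 1
          rw [← lintegral_indicator hAm]
          congr 1; ext h
          by_cases hh : h ∈ A <;> simp [hG, hh]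
      _ = (N : ℝ≥0∞) ^ 2 * ∫⁻ p, G p ∂(volume.prod volume) := by
          have hcomp := hmp.lintegral_comp_emb
            (MeasurableEquiv.shearAddRight (Rn n)).measurableEmbedding G
          rw [← hcomp]
          rw [lintegral_prod_symm (fun p => G (p.1, p.1 + p.2))
            (AEMeasurable.comp_quasiMeasurePreserving hGm hmp.quasiMeasurePreserving)]
  have hGle : ENNReal.ofReal γ₀ * ∫⁻ p, G p ∂(volume.prod volume) ≤
      ∫⁻ p in pairDomain Ω α, ‖nonlocalAdj α w p.1 p.2‖ₑ ^ 2 := by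
    rw [← lintegral_const_mul' _ _ ENNReal.ofReal_ne_top,
      ← lintegral_indicator (show MeasurableSet (pairDomain Ω α) from
        hDo.measurableSet.prod hDo.measurableSet)]
    refine lintegral_mono fun p => ?_
    by_cases hpA : p.2 - p.1 ∈ A
    swap
    · simp [hG, hpA]
    by_cases hpΩ : p.1 ∈ Ω ∨ p.2 ∈ Ω
    swap
    · push Not at hpΩ
      simp [hG, hw, hpΩ.1, hpΩ.2]
    have hlt := (hAn _ hpA).2
    have hgt := (hAn _ hpA).1
    have hp1 : p.1 ∈ totalDomain Ω α ∧ p.2 ∈ totalDomain Ω α := by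
      rw [totalDomain_eq_thickening hΩ hα hε, Metric.mem_thickening_iff, Metric.mem_thickening_iff]
      rcases hpΩ with h | h
      · exact ⟨⟨_, h, by simpa using hε⟩, ⟨_, h, by rw [dist_eq_norm]; linarith⟩⟩
      · exact ⟨⟨_, h, by rw [dist_comm, dist_eq_norm]; linarith⟩, ⟨_, h, by simpa using hε⟩⟩
    have hker : γ₀ ≤ kernel α p.1 p.2 := by
      refine hα.lower _ hp1.1 _ hp1.2 (fun h => ?_) hlt.le
      rw [h, sub_self, norm_zero] at hgt
      linarith
    have hpU : p ∈ pairDomain Ω α := hp1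
    rw [Set.indicator_of_mem hpU]
    simp only [hG, Set.indicator_of_mem hpA, Pi.one_apply, one_mul]
    rw [enorm_sq_eq_ofReal, enorm_sq_eq_ofReal, ← ENNReal.ofReal_mul hγ₀.le, norm_sq_nonlocalAdj,
      Real.norm_eq_abs, sq_abs]
    refine ENNReal.ofReal_le_ofReal ?_
    rw [mul_comm]
    exact mul_le_mul_of_nonneg_left hker (sq_nonneg _)
  rw [hR]
  refine hL.trans ?_
  rw [mul_assoc, ← ENNReal.div_eq_inv_mul, ENNReal.le_div_iff_mul_le (Or.inl hA0) (Or.inl hAt),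
    mul_comm]
  refine key.trans ?_
  rw [mul_assoc]
  gcongr
  rwa [← ENNReal.div_eq_inv_mul,
    ENNReal.le_div_iff_mul_le (Or.inl hγ) (Or.inl ENNReal.ofReal_ne_top), mul_comm]

/-! ### Existence of weak solutions -/

/-- The map `v ↦ 𝒟*v` from `V_c` to `L²(D × D; ℝⁿ)`. -/
noncomputable def adjMap (Ω : Set (Rn n)) (α : Rn n → Rn n → Rn n) :
    constrainedSpace Ω α →ₗ[ℝ] Lp (Rn n) 2 (volume.restrict (pairDomain Ω α)) where
  toFun v := v.2.1.2.toLp _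
  map_add' u v := by
    rw [← MemLp.toLp_add]
    congr 1
    funext p
    simp only [nonlocalAdj, Submodule.coe_add, Pi.add_apply]
    module
  map_smul' c v := by
    rw [RingHom.id_apply, ← MemLp.toLp_const_smul]
    congr 1
    funext p
    simp only [nonlocalAdj, Submodule.coe_smul, Pi.smul_apply, smul_eq_mul]
    module

/-- The inclusion of `V_c` into `L²(D)`. -/
noncomputable def l2Map (Ω : Set (Rn n)) (α : Rn n → Rn n → Rn n) :
    constrainedSpace Ω α →ₗ[ℝ] Lp ℝ 2 (volume.restrict (totalDomain Ω α)) where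
  toFun v := v.2.1.1.toLp _
  map_add' _ _ := rfl
  map_smul' _ _ := rfl

theorem coeFn_adjMap (v : constrainedSpace Ω α) :
    adjMap Ω α v =ᵐ[volume.restrict (pairDomain Ω α)]
      fun p => nonlocalAdj α v p.1 p.2 := MemLp.coeFn_toLp v.2.1.2

theorem energyNorm_eq_norm_adjMap (v : constrainedSpace Ω α) :
    energyNorm Ω α v = ‖adjMap Ω α v‖ := by
  rw [energyNorm, norm_eq_sqrt_real_inner, L2.inner_def]
  congr 1
  refine integral_congr_ae ?_
  filter_upwards [coeFn_adjMap v] with p hp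
  rw [hp]

theorem lintegral_enorm_sq_eq {X F : Type*} [MeasurableSpace X] {μ : Measure X}
    [NormedAddCommGroup F] {f : X → F} (hf : MemLp f 2 μ) :
    ∫⁻ x, ‖f x‖ₑ ^ 2 ∂μ = ENNReal.ofReal (‖hf.toLp f‖ ^ 2) := by
  rw [Lp.norm_toLp, ENNReal.ofReal_pow ENNReal.toReal_nonneg, ENNReal.ofReal_toReal hf.2.ne,
    eLpNorm_two_sq]

/-- The **nonlocal Poincaré inequality** on `V_c`. -/
theorem exists_norm_l2Map_le (hn : 0 < n) (hΩ : IsOpen Ω) (hΩb : Bornology.IsBounded Ω)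
    (hε : 0 < ε) (hγ₀ : 0 < γ₀) (hα : KernelConditions Ω α ε γ₀) :
    ∃ C : ℝ, 0 ≤ C ∧ ∀ v : constrainedSpace Ω α, ‖l2Map Ω α v‖ ≤ C * ‖adjMap Ω α v‖ := by
  obtain ⟨C, hC, h⟩ := exists_poincare hn hΩ hΩb hε hγ₀ hα
  refine ⟨√C.toReal, Real.sqrt_nonneg _, fun v => ?_⟩
  have hv := h v v.2
  rw [lintegral_enorm_sq_eq v.2.1.1, lintegral_enorm_sq_eq v.2.1.2,
    ← ENNReal.ofReal_toReal hC, ← ENNReal.ofReal_mul ENNReal.toReal_nonneg,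
    ENNReal.ofReal_le_ofReal_iff (by positivity)] at hv
  have h2 := Real.sqrt_le_sqrt hv
  rw [Real.sqrt_mul ENNReal.toReal_nonneg, Real.sqrt_sq (norm_nonneg _),
    Real.sqrt_sq (norm_nonneg _)] at h2
  exact h2

/-- `V_c` is complete in the energy norm: by the Poincaré inequality, energy-Cauchy sequences
converge in `L²(D)`, and `𝒟*` passes to almost everywhere limits. -/
theorem isClosed_range_adjMap (hn : 0 < n) (hΩ : IsOpen Ω) (hΩb : Bornology.IsBounded Ω)
    (hε : 0 < ε) (hγ₀ : 0 < γ₀) (hα : KernelConditions Ω α ε γ₀) :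
    IsClosed (LinearMap.range (adjMap Ω α) :
      Set (Lp (Rn n) 2 (volume.restrict (pairDomain Ω α)))) := by
  obtain ⟨C, hC0, hC⟩ := exists_norm_l2Map_le hn hΩ hΩb hε hγ₀ hα
  refine IsSeqClosed.isClosed fun Fs F hFs hF => ?_
  choose v hv using fun k => LinearMap.mem_range.1 (hFs k)
  have hcau : CauchySeq fun k => l2Map Ω α (v k) := by
    have h1 := Metric.cauchySeq_iff.1 hF.cauchySeq
    refine Metric.cauchySeq_iff.2 fun η hη => ?_
    obtain ⟨N, hN⟩ := h1 (η / (C + 1)) (by positivity)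
    refine ⟨N, fun k hk l hl => ?_⟩
    have h2 := hN k hk l hl
    rw [dist_eq_norm, ← hv, ← hv, ← map_sub, lt_div_iff₀ (by positivity)] at h2
    rw [dist_eq_norm, ← map_sub]
    refine (hC _).trans_lt (lt_of_le_of_lt ?_ h2)
    nlinarith [norm_nonneg (adjMap Ω α (v k - v l))]
  obtain ⟨g, hg⟩ := cauchySeq_tendsto_of_complete hcau
  -- along a subsequence, `v k → g` and `𝒟*(v k) → F` almost everywhere
  obtain ⟨ns, hns, hgae⟩ := (tendstoInMeasure_of_tendsto_Lp hg).exists_seq_tendsto_ae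
  obtain ⟨ms, hms, hFae⟩ :=
    (tendstoInMeasure_of_tendsto_Lp (hF.comp hns.tendsto_atTop)).exists_seq_tendsto_ae
  have hvg : ∀ᵐ x ∂(volume.restrict (totalDomain Ω α)),
      Tendsto (fun j => (v (ns (ms j)) : Rn n → ℝ) x) atTop (𝓝 (g x)) := by
    have := ae_all_iff.2 fun k => MemLp.coeFn_toLp (v k).2.1.1
    filter_upwards [hgae, this] with x hx hx2
    refine (hx.comp hms.tendsto_atTop).congr fun j => ?_
    exact hx2 _
  have hDg : (fun p : Rn n × Rn n => nonlocalAdj α g p.1 p.2)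
      =ᵐ[volume.restrict (pairDomain Ω α)] F := by
    have := ae_all_iff.2 fun k => coeFn_adjMap (v k)
    filter_upwards [ae_pairDomain_of_ae hvg, this, hFae] with p hp hp2 hp3
    refine tendsto_nhds_unique (((hp.2.sub hp.1).smul_const (α p.1 p.2)).neg) ?_
    refine hp3.congr fun j => ?_
    simp only [Function.comp_apply]
    rw [← hv, hp2]
    rfl
  have hgm : MemLp (fun p : Rn n × Rn n => nonlocalAdj α g p.1 p.2) 2
      (volume.restrict (pairDomain Ω α)) := (memLp_congr_ae hDg).2 (Lp.memLp F)
  have hg0 : ∀ᵐ x ∂(volume.restrict (interactionDomain Ω α)), g x = 0 := by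
    have h1 := ae_all_iff.2 fun k => (v k).2.2
    have h2 := ae_restrict_of_ae_restrict_of_subset
      (show interactionDomain Ω α ⊆ totalDomain Ω α from Set.subset_union_right) hvg
    filter_upwards [h1, h2] with x hx1 hx2
    simp only [hx1] at hx2
    exact tendsto_nhds_unique hx2 tendsto_const_nhds
  refine ⟨⟨g, ⟨⟨Lp.memLp g, hgm⟩, hg0⟩⟩, ?_⟩
  exact Lp.ext ((coeFn_adjMap _).trans hDg)

theorem integrable_mul_inner {X F : Type*} [MeasurableSpace X] {μ : Measure X}
    [NormedAddCommGroup F] [InnerProductSpace ℝ F] {θ : X → ℝ} {f g : X → F}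
    (hθ : MemLp θ ∞ μ) (hf : MemLp f 2 μ) (hg : MemLp g 2 μ) :
    Integrable (fun x => θ x * inner ℝ (f x) (g x)) μ := by
  have h1 : Integrable (fun x => inner ℝ (f x) (g x)) μ := by
    have := L2.integrable_inner (𝕜 := ℝ) (hf.toLp f) (hg.toLp g)
    refine this.congr ?_
    filter_upwards [hf.coeFn_toLp, hg.coeFn_toLp] with x h1 h2
    rw [h1, h2]
  exact (MemLp.integrable_mul (p := ∞) (q := 1) hθ (memLp_one_iff_integrable.2 h1))

/-- The bilinear form `(F, G) ↦ ∫ θ F · G` on `L²`. -/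
noncomputable def weightedForm {X F : Type*} [MeasurableSpace X] {μ : Measure X}
    [NormedAddCommGroup F] [InnerProductSpace ℝ F] {θ : X → ℝ} (hθ : MemLp θ ∞ μ) :
    Lp F 2 μ →L[ℝ] Lp F 2 μ →L[ℝ] ℝ :=
  LinearMap.mkContinuous₂
    (LinearMap.mk₂ ℝ (fun f g : Lp F 2 μ => ∫ x, θ x * inner ℝ (f x) (g x) ∂μ)
      (fun f f' g => by
        rw [← integral_add (integrable_mul_inner hθ (Lp.memLp f) (Lp.memLp g))
          (integrable_mul_inner hθ (Lp.memLp f') (Lp.memLp g))]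
        refine integral_congr_ae ?_
        filter_upwards [Lp.coeFn_add f f'] with x hx
        rw [hx, Pi.add_apply, inner_add_left, mul_add])
      (fun c f g => by
        rw [smul_eq_mul, ← integral_const_mul]
        refine integral_congr_ae ?_
        filter_upwards [Lp.coeFn_smul c f] with x hx
        rw [hx, Pi.smul_apply, real_inner_smul_left]; ring)
      (fun f g g' => by
        rw [← integral_add (integrable_mul_inner hθ (Lp.memLp f) (Lp.memLp g))
          (integrable_mul_inner hθ (Lp.memLp f) (Lp.memLp g'))]
        refine integral_congr_ae ?_
        filter_upwards [Lp.coeFn_add g g'] with x hx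
        rw [hx, Pi.add_apply, inner_add_right, mul_add])
      (fun c f g => by
        rw [smul_eq_mul, ← integral_const_mul]
        refine integral_congr_ae ?_
        filter_upwards [Lp.coeFn_smul c g] with x hx
        rw [hx, Pi.smul_apply, real_inner_smul_right]; ring))
    (eLpNorm θ ∞ μ).toReal
    (fun f g => by
      -- Cauchy-Schwarz for `θ • f` and `g`
      have hθf : MemLp (θ • (f : X → F)) 2 μ := (Lp.memLp f).smul hθ
      have h1 : ∫ x, θ x * inner ℝ (f x) (g x) ∂μ = inner ℝ (hθf.toLp _) g := by
        rw [L2.inner_def]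
        refine integral_congr_ae ?_
        filter_upwards [hθf.coeFn_toLp] with x hx
        rw [hx, Pi.smul_apply', real_inner_smul_left]
      rw [LinearMap.mk₂_apply, h1]
      refine (norm_inner_le_norm _ _).trans (mul_le_mul_of_nonneg_right ?_ (norm_nonneg _))
      rw [Lp.norm_toLp, Lp.norm_def, ← ENNReal.toReal_mul]
      exact ENNReal.toReal_mono (ENNReal.mul_ne_top hθ.2.ne (Lp.eLpNorm_ne_top f))
        (eLpNorm_smul_le_eLpNorm_top_mul_eLpNorm 2 (Lp.aestronglyMeasurable f) θ))

theorem weightedForm_apply {X F : Type*} [MeasurableSpace X] {μ : Measure X}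
    [NormedAddCommGroup F] [InnerProductSpace ℝ F] {θ : X → ℝ} (hθ : MemLp θ ∞ μ)
    (f g : Lp F 2 μ) : weightedForm hθ f g = ∫ x, θ x * inner ℝ (f x) (g x) ∂μ := rfl

/-- The Lax-Milgram theorem for a form pulled back along a linear map `T` with closed range, and
a functional bounded in the seminorm `v ↦ ‖T v‖`. -/
theorem exists_form_eq_of_isClosed_range {V H : Type*} [AddCommGroup V] [Module ℝ V]
    [NormedAddCommGroup H] [InnerProductSpace ℝ H] [CompleteSpace H] (T : V →ₗ[ℝ] H)
    (hT : IsClosed (LinearMap.range T : Set H)) (B : H →L[ℝ] H →L[ℝ] ℝ) {c : ℝ} (hc : 0 < c)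
    (hB : ∀ F, c * ‖F‖ * ‖F‖ ≤ B F F) (f : V →ₗ[ℝ] ℝ) {M : ℝ} (hM : ∀ v, |f v| ≤ M * ‖T v‖) :
    ∃ u, ∀ v, B (T u) (T v) = f v := by
  have : CompleteSpace (LinearMap.range T) := hT.completeSpace_coe
  -- `f` factors through `T`
  obtain ⟨g, hg⟩ := T.rangeRestrict.exists_rightInverse_of_surjective
    (LinearMap.range_rangeRestrict _)
  have hfg : ∀ v, f (g (T.rangeRestrict v)) = f v := by
    intro v
    have h1 : T (g (T.rangeRestrict v) - v) = 0 := by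
      rw [map_sub, sub_eq_zero]
      exact congrArg Subtype.val (LinearMap.congr_fun hg (T.rangeRestrict v))
    have h2 := hM (g (T.rangeRestrict v) - v)
    rw [h1, norm_zero, mul_zero, abs_nonpos_iff, map_sub, sub_eq_zero] at h2
    exact h2
  let fC : LinearMap.range T →L[ℝ] ℝ := (f ∘ₗ g).mkContinuous M (by
    rintro ⟨F, v, rfl⟩
    have := hM v
    rw [← hfg] at this
    exact this)
  let B' : LinearMap.range T →L[ℝ] LinearMap.range T →L[ℝ] ℝ :=
    B.bilinearComp (LinearMap.range T).subtypeL (LinearMap.range T).subtypeL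
  have hB' : IsCoercive B' := ⟨c, hc, fun F => hB F⟩
  obtain ⟨⟨F, u, hu⟩, hFe⟩ : ∃ F, ∀ G, B' F G = fC G := by
    refine ⟨hB'.continuousLinearEquivOfBilin.symm ((InnerProductSpace.toDual ℝ _).symm fC),
      fun G => ?_⟩
    rw [← hB'.continuousLinearEquivOfBilin_apply]
    simp
  refine ⟨u, fun v => ?_⟩
  rw [← hfg v, hu]
  exact hFe (T.rangeRestrict v)

/-- Only a lower bound and boundedness of the diffusivity are needed for solvability. -/
theorem exists_isWeakSolution (hn : 0 < n) (hΩ : IsOpen Ω) (hΩb : Bornology.IsBounded Ω)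
    (hε : 0 < ε) (hγ₀ : 0 < γ₀) (hα : KernelConditions Ω α ε γ₀) {θ₀ : ℝ} (hθ₀ : 0 < θ₀)
    {f : constrainedSpace Ω α →ₗ[ℝ] ℝ} (hf : IsEnergyBounded Ω α f) {θ : Rn n × Rn n → ℝ}
    (hθ : MemLp θ ∞ (volume.restrict (pairDomain Ω α)))
    (hθ' : ∀ᵐ p ∂(volume.restrict (pairDomain Ω α)), θ₀ ≤ θ p) :
    ∃ u, IsWeakSolution Ω α f θ u := by
  obtain ⟨M, hM⟩ := hf
  simp_rw [energyNorm_eq_norm_adjMap] at hM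
  obtain ⟨u, hu⟩ := exists_form_eq_of_isClosed_range (adjMap Ω α)
    (isClosed_range_adjMap hn hΩ hΩb hε hγ₀ hα) (weightedForm hθ) hθ₀ (fun F => by
      rw [mul_assoc, ← real_inner_self_eq_norm_mul_norm, L2.inner_def, weightedForm_apply,
        ← integral_const_mul]
      refine integral_mono_ae ((L2.integrable_inner _ _).const_mul _)
        (integrable_mul_inner hθ (Lp.memLp _) (Lp.memLp _)) ?_
      filter_upwards [hθ'] with p hp
      exact mul_le_mul_of_nonneg_right hp real_inner_self_nonneg) f hM
  refine ⟨u, u.2, fun v => ?_⟩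
  rw [← hu v, weightedForm_apply]
  refine integral_congr_ae ?_
  filter_upwards [coeFn_adjMap u, coeFn_adjMap v] with p h1 h2
  rw [h1, h2]

/-! ### Stability of weak solutions in the diffusivity -/

theorem norm_sq_adjMap (v : constrainedSpace Ω α) :
    ‖adjMap Ω α v‖ ^ 2 = ∫ p in pairDomain Ω α, ‖nonlocalAdj α v p.1 p.2‖ ^ 2 := by
  rw [← real_inner_self_eq_norm_sq, L2.inner_def]
  refine integral_congr_ae ?_
  filter_upwards [coeFn_adjMap v] with p hp
  rw [hp, real_inner_self_eq_norm_sq]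

/-- If `u` and `u'` solve the problems with diffusivities `θ` and `θ'`, then testing both
with `u' - u` controls the energy of `u' - u` by the weighted energy of `u`. -/
theorem IsWeakSolution.norm_sq_sub_le {f : constrainedSpace Ω α →ₗ[ℝ] ℝ} {θ₀ : ℝ} (hθ₀ : 0 < θ₀)
    {θ θ' : Rn n × Rn n → ℝ} (hθ : MemLp θ ∞ (volume.restrict (pairDomain Ω α)))
    (hθ' : MemLp θ' ∞ (volume.restrict (pairDomain Ω α)))
    (hlb : ∀ᵐ p ∂(volume.restrict (pairDomain Ω α)), θ₀ ≤ θ' p)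
    {u u' : constrainedSpace Ω α} (hu : IsWeakSolution Ω α f θ u)
    (hu' : IsWeakSolution Ω α f θ' u')
    (hi : Integrable (fun p : Rn n × Rn n => (θ' p - θ p) ^ 2 * ‖nonlocalAdj α u p.1 p.2‖ ^ 2)
      (volume.restrict (pairDomain Ω α))) :
    θ₀ ^ 2 * ‖adjMap Ω α (u' - u)‖ ^ 2 ≤
      ∫ p in pairDomain Ω α, (θ' p - θ p) ^ 2 * ‖nonlocalAdj α u p.1 p.2‖ ^ 2 := by
  set d : constrainedSpace Ω α := u' - u with hd
  have i1 := integrable_mul_inner hθ' u'.2.1.2 d.2.1.2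
  have i2 := integrable_mul_inner hθ u.2.1.2 d.2.1.2
  have i3 : Integrable (fun p : Rn n × Rn n => ‖nonlocalAdj α d p.1 p.2‖ ^ 2)
      (volume.restrict (pairDomain Ω α)) := d.2.1.2.integrable_norm_pow (by norm_num)
  have i12 : Integrable (fun p : Rn n × Rn n =>
      θ' p * inner ℝ (nonlocalAdj α u' p.1 p.2) (nonlocalAdj α d p.1 p.2) -
        θ p * inner ℝ (nonlocalAdj α u p.1 p.2) (nonlocalAdj α d p.1 p.2))
      (volume.restrict (pairDomain Ω α)) := i1.sub i2
  have hz : ∫ p in pairDomain Ω α,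
      (θ' p * inner ℝ (nonlocalAdj α u' p.1 p.2) (nonlocalAdj α d p.1 p.2) -
        θ p * inner ℝ (nonlocalAdj α u p.1 p.2) (nonlocalAdj α d p.1 p.2)) = 0 := by
    rw [integral_sub i1 i2, hu.2 d, hu'.2 d, sub_self]
  have key : θ₀ ^ 2 * ‖adjMap Ω α d‖ ^ 2 - 2 * θ₀ * 0 ≤
      ∫ p in pairDomain Ω α, (θ' p - θ p) ^ 2 * ‖nonlocalAdj α u p.1 p.2‖ ^ 2 := by
    rw [norm_sq_adjMap, ← integral_const_mul, ← hz, ← integral_const_mul,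
      ← integral_sub (i3.const_mul _) (i12.const_mul _)]
    refine integral_mono_ae ((i3.const_mul _).sub (i12.const_mul _)) hi ?_
    filter_upwards [hlb] with p hp
    have e : nonlocalAdj α u' p.1 p.2 = nonlocalAdj α u p.1 p.2 + nonlocalAdj α d p.1 p.2 := by
      simp only [nonlocalAdj, hd, Submodule.coe_sub, Pi.sub_apply]
      module
    rw [e, inner_add_left, real_inner_self_eq_norm_sq]
    -- Young's inequality in the form `0 ≤ ‖(θ' - θ) • P + θ₀ • Q‖²`
    have hy : 0 ≤ ‖(θ' p - θ p) • nonlocalAdj α u p.1 p.2 +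
        θ₀ • nonlocalAdj α (d : Rn n → ℝ) p.1 p.2‖ ^ 2 := sq_nonneg _
    rw [norm_add_sq_real, norm_smul, norm_smul, mul_pow, mul_pow, real_inner_smul_left,
      real_inner_smul_right, Real.norm_eq_abs, Real.norm_eq_abs, sq_abs, sq_abs] at hy
    have h3 : 0 ≤ θ₀ * ((θ' p - θ₀) * ‖nonlocalAdj α (d : Rn n → ℝ) p.1 p.2‖ ^ 2) :=
      mul_nonneg hθ₀.le (mul_nonneg (sub_nonneg.2 hp) (sq_nonneg _))
    linarith
  simpa using key

/-- If diffusivities between common positive bounds converge almost everywhere, then the weak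
solutions converge strongly in energy. -/
theorem tendsto_norm_adjMap_sub {f : constrainedSpace Ω α →ₗ[ℝ] ℝ} {θ₀ θ₁ : ℝ} (hθ₀ : 0 < θ₀)
    {θ : ℕ → Rn n × Rn n → ℝ} {θ' : Rn n × Rn n → ℝ}
    (hθ : ∀ k, MemLp (θ k) ∞ (volume.restrict (pairDomain Ω α)))
    (hθ' : MemLp θ' ∞ (volume.restrict (pairDomain Ω α)))
    (hb : ∀ k, ∀ᵐ p ∂(volume.restrict (pairDomain Ω α)), θ₀ ≤ θ k p ∧ θ k p ≤ θ₁)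
    (hb' : ∀ᵐ p ∂(volume.restrict (pairDomain Ω α)), θ₀ ≤ θ' p ∧ θ' p ≤ θ₁)
    (hlim : ∀ᵐ p ∂(volume.restrict (pairDomain Ω α)), Tendsto (fun k => θ k p) atTop (𝓝 (θ' p)))
    {u : ℕ → constrainedSpace Ω α} {u' : constrainedSpace Ω α}
    (hu : ∀ k, IsWeakSolution Ω α f (θ k) (u k)) (hu' : IsWeakSolution Ω α f θ' u') :
    Tendsto (fun k => ‖adjMap Ω α (u k - u')‖) atTop (𝓝 0) := by
  set P : Rn n × Rn n → ℝ := fun p => ‖nonlocalAdj α u' p.1 p.2‖ ^ 2 with hP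
  have hPi : Integrable P (volume.restrict (pairDomain Ω α)) :=
    u'.2.1.2.integrable_norm_pow (by norm_num)
  have hm : ∀ k, AEStronglyMeasurable (fun p => (θ k p - θ' p) ^ 2 * P p)
      (volume.restrict (pairDomain Ω α)) := fun k =>
    (((hθ k).1.sub hθ'.1).pow 2).mul hPi.1
  have hle : ∀ k, ∀ᵐ p ∂(volume.restrict (pairDomain Ω α)),
      ‖(θ k p - θ' p) ^ 2 * P p‖ ≤ (θ₁ - θ₀) ^ 2 * P p := by
    intro k
    filter_upwards [hb k, hb'] with p h1 h2
    have hP0 : 0 ≤ P p := sq_nonneg _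
    rw [Real.norm_of_nonneg (mul_nonneg (sq_nonneg _) hP0)]
    refine mul_le_mul_of_nonneg_right (sq_le_sq' ?_ ?_) hP0 <;> linarith
  have hdct : Tendsto (fun k => ∫ p in pairDomain Ω α, (θ k p - θ' p) ^ 2 * P p) atTop (𝓝 0) := by
    have := tendsto_integral_of_dominated_convergence (fun p => (θ₁ - θ₀) ^ 2 * P p) hm
      (hPi.const_mul _) hle (f := fun _ => 0) (by
        filter_upwards [hlim] with p hp
        have h1 : Tendsto (fun k => (θ k p - θ' p) ^ 2 * P p) atTop
            (𝓝 ((θ' p - θ' p) ^ 2 * P p)) := ((hp.sub_const _).pow 2).mul_const _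
        simpa using h1)
    simpa using this
  have hsq : Tendsto (fun k => ‖adjMap Ω α (u k - u')‖ ^ 2) atTop (𝓝 0) := by
    have h2 : Tendsto (fun k => (θ₀ ^ 2)⁻¹ *
        ∫ p in pairDomain Ω α, (θ k p - θ' p) ^ 2 * P p) atTop (𝓝 0) := by
      simpa using hdct.const_mul (θ₀ ^ 2)⁻¹
    refine squeeze_zero (fun k => sq_nonneg _) (fun k => ?_) h2
    rw [le_inv_mul_iff₀ (by positivity)]
    exact hu'.norm_sq_sub_le hθ₀ hθ' (hθ k) ((hb k).mono fun p hp => hp.1) (hu k)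
      (((hPi.const_mul _).mono' (hm k) (hle k)))
  have := hsq.sqrt
  simpa [Real.sqrt_sq] using this

theorem tendsto_cost {uhat : Rn n → ℝ} (huhat : MemLp uhat 2 (volume.restrict Ω))
    {u : ℕ → constrainedSpace Ω α} {u' : constrainedSpace Ω α}
    (h : Tendsto (fun k => ‖l2Map Ω α (u k - u')‖) atTop (𝓝 0)) :
    Tendsto (fun k => cost Ω uhat (u k)) atTop (𝓝 (cost Ω uhat u')) := by
  have hsub : Ω ⊆ totalDomain Ω α := Set.subset_union_left
  have hmem : ∀ v : constrainedSpace Ω α, MemLp v.1 2 (volume.restrict Ω) :=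
    fun v => v.2.1.1.mono_measure (Measure.restrict_mono hsub le_rfl)
  let a : constrainedSpace Ω α → Lp ℝ 2 (volume.restrict Ω) := fun v =>
    ((hmem v).sub huhat).toLp _
  have hcost : ∀ v : constrainedSpace Ω α, cost Ω uhat v = 1 / 2 * ‖a v‖ ^ 2 := by
    intro v
    rw [cost, ← real_inner_self_eq_norm_sq, L2.inner_def]
    congr 1
    refine integral_congr_ae ?_
    filter_upwards [((hmem v).sub huhat).coeFn_toLp] with x hx
    rw [hx]
    simp [sq]
  have ha : Tendsto (fun k => a (u k)) atTop (𝓝 (a u')) := by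
    rw [tendsto_iff_norm_sub_tendsto_zero]
    refine squeeze_zero (fun _ => norm_nonneg _) (fun k => ?_) h
    rw [← MemLp.toLp_sub, Lp.norm_toLp]
    have e : (u k).1 - uhat - (u'.1 - uhat) = (u k - u').1 := by
      simp
    rw [e]
    change _ ≤ ‖((u k - u').2.1.1.toLp _)‖
    rw [Lp.norm_toLp]
    exact ENNReal.toReal_mono (u k - u').2.1.1.2.ne
      (eLpNorm_mono_measure _ (Measure.restrict_mono hsub le_rfl))
  simp_rw [hcost]
  exact (ha.norm.pow 2).const_mul _

/-! ### Symmetrization -/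

theorem measurePreserving_swap_pairDomain (Ω : Set (Rn n)) (α : Rn n → Rn n → Rn n) :
    MeasurePreserving Prod.swap ((volume : Measure (Rn n × Rn n)).restrict (pairDomain Ω α))
      (volume.restrict (pairDomain Ω α)) := by
  rw [volume_restrict_pairDomain]
  exact Measure.measurePreserving_swap

theorem setIntegral_pairDomain_comp_swap (F : Rn n × Rn n → ℝ) :
    ∫ p in pairDomain Ω α, F p.swap = ∫ p in pairDomain Ω α, F p :=
  (measurePreserving_swap_pairDomain Ω α).integral_comp
    MeasurableEquiv.prodComm.measurableEmbedding F

theorem HasWeakDirDeriv.comp_swap {θ g : Rn n × Rn n → ℝ} {w : Rn n × Rn n}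
    (h : HasWeakDirDeriv (pairDomain Ω α) θ g w) :
    HasWeakDirDeriv (pairDomain Ω α) (fun p => θ p.swap) (fun p => g p.swap) w.swap := by
  intro φ h1 h2 h3
  let e : (Rn n × Rn n) ≃L[ℝ] (Rn n × Rn n) := ContinuousLinearEquiv.prodComm ℝ (Rn n) (Rn n)
  have hd : ∀ p, fderiv ℝ (φ ∘ e) p w = fderiv ℝ φ p.swap w.swap := by
    intro p
    rw [e.comp_right_fderiv]
    rfl
  have hs : tsupport (φ ∘ e) ⊆ pairDomain Ω α := by
    intro p hp
    have hp' := h3 (tsupport_comp_subset_preimage φ e.continuous hp)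
    exact ⟨hp'.2, hp'.1⟩
  have key := h (φ ∘ e) (h1.comp e.contDiff) (h2.comp_homeomorph e.toHomeomorph) hs
  simp only [hd] at key
  rw [← setIntegral_pairDomain_comp_swap, ← setIntegral_pairDomain_comp_swap (fun p => g p * _)]
    at key
  simpa [e] using key

theorem W1InftyNormLE.comp_swap {θ : Rn n × Rn n → ℝ} {K : ℝ}
    (h : W1InftyNormLE (pairDomain Ω α) θ K) :
    W1InftyNormLE (pairDomain Ω α) (fun p => θ p.swap) K := by
  have hmp := measurePreserving_swap_pairDomain Ω α
  refine ⟨h.1.comp_measurePreserving hmp,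
    (eLpNorm_comp_measurePreserving h.1.1 hmp).trans_le h.2.1, fun k => ?_⟩
  obtain ⟨g, hg, hgd, hgK⟩ := h.2.2 k.swap
  refine ⟨fun p => g p.swap, hg.comp_measurePreserving hmp, ?_,
    (eLpNorm_comp_measurePreserving hg.1 hmp).trans_le hgK⟩
  have := hgd.comp_swap
  rcases k with i | i <;> exact this

theorem eLpNorm_top_midpoint_le {X : Type*} [MeasurableSpace X] {μ : Measure X} {a b : X → ℝ}
    {K : ℝ} (ha : eLpNorm a ∞ μ ≤ ENNReal.ofReal K) (hb : eLpNorm b ∞ μ ≤ ENNReal.ofReal K) :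
    eLpNorm (fun x => (1 / 2 : ℝ) * (a x + b x)) ∞ μ ≤ ENNReal.ofReal K := by
  refine eLpNorm_top_le_of_ae_abs_le ?_
  filter_upwards [ae_abs_le_of_eLpNorm_top_le ha, ae_abs_le_of_eLpNorm_top_le hb] with x h1 h2
  rw [abs_le] at h1 h2 ⊢
  constructor <;> linarith

theorem W1InftyNormLE.midpoint {U : Set (Rn n × Rn n)} (hUfin : volume U ≠ ⊤)
    {θ θ' : Rn n × Rn n → ℝ} {K : ℝ} (h : W1InftyNormLE U θ K) (h' : W1InftyNormLE U θ' K) :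
    W1InftyNormLE U (fun p => (1 / 2 : ℝ) * (θ p + θ' p)) K := by
  have : IsFiniteMeasure (volume.restrict U) := ⟨by simpa using hUfin.lt_top⟩
  refine ⟨(h.1.add h'.1).const_mul _, eLpNorm_top_midpoint_le h.2.1 h'.2.1, fun k => ?_⟩
  obtain ⟨g, hg, hgd, hgK⟩ := h.2.2 k
  obtain ⟨g', hg', hgd', hgK'⟩ := h'.2.2 k
  refine ⟨_, (hg.add hg').const_mul _, fun φ h1 h2 h3 => ?_, eLpNorm_top_midpoint_le hgK hgK'⟩
  have hlin : ∀ a b ψ : Rn n × Rn n → ℝ, MemLp a ∞ (volume.restrict U) →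
      MemLp b ∞ (volume.restrict U) → MemLp ψ 2 (volume.restrict U) →
      ∫ p in U, (1 / 2 : ℝ) * (a p + b p) * ψ p =
        (1 / 2 : ℝ) * ((∫ p in U, a p * ψ p) + ∫ p in U, b p * ψ p) := by
    intro a b ψ ha hb hψ
    have ia : Integrable (fun p => a p * ψ p) (volume.restrict U) :=
      (ha.mono_exponent le_top : MemLp a 2 _).integrable_mul hψ
    have ib : Integrable (fun p => b p * ψ p) (volume.restrict U) :=
      (hb.mono_exponent le_top : MemLp b 2 _).integrable_mul hψ
    rw [← integral_add ia ib, ← integral_const_mul]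
    congr 1; ext p
    ring
  have e1 := hlin _ _ _ h.1 h'.1 (memLp_fderiv_of_test h1 h2 (coordDir k))
  have e2 := hlin _ _ _ hg hg' (memLp_of_test h1 h2)
  rw [e1, hgd φ h1 h2 h3, hgd' φ h1 h2 h3]
  refine Eq.trans ?_ (congrArg Neg.neg e2).symm
  ring

theorem nonlocalAdj_swap (hα : ∀ x y, α x y = -α y x) (v : Rn n → ℝ) (x y : Rn n) :
    nonlocalAdj α v y x = nonlocalAdj α v x y := by
  rw [nonlocalAdj, nonlocalAdj, hα y x]
  module

/-- Replacing the diffusivity by its symmetric part does not change the weak problem, because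
`𝒟*u · 𝒟*v` is symmetric. -/
theorem IsWeakSolution.symmetrize (hα : ∀ x y, α x y = -α y x)
    {f : constrainedSpace Ω α →ₗ[ℝ] ℝ} {θ : Rn n × Rn n → ℝ}
    (hθ : MemLp θ ∞ (volume.restrict (pairDomain Ω α))) {u : Rn n → ℝ}
    (hu : IsWeakSolution Ω α f θ u) :
    IsWeakSolution Ω α f (fun p => (1 / 2 : ℝ) * (θ p + θ p.swap)) u := by
  refine ⟨hu.1, fun v => ?_⟩
  have hmp := measurePreserving_swap_pairDomain Ω α
  have e := setIntegral_pairDomain_comp_swap (Ω := Ω) (α := α)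
    (fun p => θ p * inner ℝ (nonlocalAdj α u p.1 p.2) (nonlocalAdj α v p.1 p.2))
  simp only [Prod.fst_swap, Prod.snd_swap, nonlocalAdj_swap hα _ (Prod.fst _) (Prod.snd _)] at e
  have i1 := integrable_mul_inner hθ hu.1.1.2 v.2.1.2
  have i2 : Integrable (fun p : Rn n × Rn n => θ p.swap *
      inner ℝ (nonlocalAdj α u p.1 p.2) (nonlocalAdj α v p.1 p.2))
      (volume.restrict (pairDomain Ω α)) :=
    integrable_mul_inner (hθ.comp_measurePreserving hmp) hu.1.1.2 v.2.1.2
  have hsplit : ∫ p in pairDomain Ω α, (1 / 2 : ℝ) * (θ p + θ p.swap) *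
      inner ℝ (nonlocalAdj α u p.1 p.2) (nonlocalAdj α v p.1 p.2) =
      (1 / 2 : ℝ) * ((∫ p in pairDomain Ω α,
          θ p * inner ℝ (nonlocalAdj α u p.1 p.2) (nonlocalAdj α v p.1 p.2)) +
        ∫ p in pairDomain Ω α,
          θ p.swap * inner ℝ (nonlocalAdj α u p.1 p.2) (nonlocalAdj α v p.1 p.2)) := by
    rw [← integral_add i1 i2, ← integral_const_mul]
    congr 1; ext p
    ring
  rw [hsplit, e, hu.2 v]
  ring

theorem volume_pairDomain_ne_top (hΩ : IsOpen Ω) (hΩb : Bornology.IsBounded Ω) (hε : 0 < ε)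
    (hα : KernelConditions Ω α ε γ₀) : volume (pairDomain Ω α) ≠ ⊤ := by
  have hD : Bornology.IsBounded (totalDomain Ω α) := by
    rw [totalDomain_eq_thickening hΩ hα hε]; exact hΩb.thickening
  exact (hD.prod hD).measure_lt_top.ne

theorem symmetrize_mem_admissible {θ₀ θ₁ K : ℝ} (hfin : volume (pairDomain Ω α) ≠ ⊤)
    {θ : Rn n × Rn n → ℝ} (hθ : θ ∈ admissible Ω α θ₀ θ₁ K) :
    (fun p => (1 / 2 : ℝ) * (θ p + θ p.swap)) ∈ admissible Ω α θ₀ θ₁ K := by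
  refine ⟨hθ.1.midpoint hfin hθ.1.comp_swap, ?_⟩
  filter_upwards [hθ.2, (measurePreserving_swap_pairDomain Ω α).quasiMeasurePreserving.ae hθ.2]
    with p h1 h2
  constructor <;> linarith

/-! ### Existence of minimizers -/

/-- The direct method: a minimizing sequence of diffusivities has an admissible almost everywhere
limit, and the cost is continuous along it. -/
theorem exists_minimizer (hn : 0 < n) (hΩ : IsOpen Ω) (hΩb : Bornology.IsBounded Ω)
    (hε : 0 < ε) (hγ₀ : 0 < γ₀) (hα : KernelConditions Ω α ε γ₀) {θ₀ θ₁ K : ℝ} (hθ₀ : 0 < θ₀)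
    (hadm : (admissible Ω α θ₀ θ₁ K).Nonempty)
    {f : constrainedSpace Ω α →ₗ[ℝ] ℝ} (hf : IsEnergyBounded Ω α f)
    {uhat : Rn n → ℝ} (huhat : MemLp uhat 2 (volume.restrict Ω)) :
    ∃ θ ∈ admissible Ω α θ₀ θ₁ K, ∃ u : Rn n → ℝ, IsWeakSolution Ω α f θ u ∧
      ∀ θ' ∈ admissible Ω α θ₀ θ₁ K, ∀ u' : Rn n → ℝ,
        IsWeakSolution Ω α f θ' u' → cost Ω uhat u ≤ cost Ω uhat u' := by
  have hfin := volume_pairDomain_ne_top hΩ hΩb hε hα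
  have hDo := isOpen_totalDomain hΩ hα hε
  have hex : ∀ θ ∈ admissible Ω α θ₀ θ₁ K, ∃ u, IsWeakSolution Ω α f θ u := fun θ hθ =>
    exists_isWeakSolution hn hΩ hΩb hε hγ₀ hα hθ₀ hf hθ.1.1 (hθ.2.mono fun p hp => hp.1)
  set S : Set ℝ := {c | ∃ θ ∈ admissible Ω α θ₀ θ₁ K, ∃ u, IsWeakSolution Ω α f θ u ∧
    cost Ω uhat u = c} with hS
  have hSne : S.Nonempty := by
    obtain ⟨θ, hθ⟩ := hadm
    obtain ⟨u, hu⟩ := hex θ hθ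
    exact ⟨_, θ, hθ, u, hu, rfl⟩
  have hSb : BddBelow S := by
    refine ⟨0, ?_⟩
    rintro _ ⟨θ, -, u, -, rfl⟩
    exact mul_nonneg (by norm_num) (integral_nonneg fun x => sq_nonneg _)
  obtain ⟨c, -, hc, hcS⟩ := exists_seq_tendsto_sInf hSne hSb
  choose θ hθ u hu hcu using hcS
  obtain ⟨θ', ns, hns, hθ', hlim⟩ := exists_subseq_tendsto_ae_of_W1InftyNormLE
    (hDo.prod hDo : IsOpen (pairDomain Ω α)) hfin fun k => (hθ k).1
  have hb' : ∀ᵐ p ∂(volume.restrict (pairDomain Ω α)), θ₀ ≤ θ' p ∧ θ' p ≤ θ₁ := by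
    filter_upwards [hlim, ae_all_iff.2 fun k => (hθ k).2] with p h1 h2
    exact ⟨ge_of_tendsto' h1 fun j => (h2 _).1, le_of_tendsto' h1 fun j => (h2 _).2⟩
  obtain ⟨u', hu'⟩ := hex θ' ⟨hθ', hb'⟩
  refine ⟨θ', ⟨hθ', hb'⟩, u', hu', fun θ'' hθ'' u'' hu'' => ?_⟩
  let us : ℕ → constrainedSpace Ω α := fun j => ⟨u (ns j), (hu (ns j)).1⟩
  let us' : constrainedSpace Ω α := ⟨u', hu'.1⟩
  have hadj : Tendsto (fun j => ‖adjMap Ω α (us j - us')‖) atTop (𝓝 0) :=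
    tendsto_norm_adjMap_sub hθ₀ (fun j => (hθ (ns j)).1.1) hθ'.1
    (fun j => (hθ (ns j)).2) hb' hlim (u := us) (u' := us') (fun j => hu (ns j)) hu'
  obtain ⟨C, -, hC⟩ := exists_norm_l2Map_le hn hΩ hΩb hε hγ₀ hα
  have hadjC : Tendsto (fun j => C * ‖adjMap Ω α (us j - us')‖) atTop (𝓝 0) := by
    simpa using hadj.const_mul C
  have hl2 : Tendsto (fun j => ‖l2Map Ω α (us j - us')‖) atTop (𝓝 0) :=
    squeeze_zero (fun _ => norm_nonneg _) (fun j => hC (us j - us')) hadjC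
  have hcost := tendsto_cost huhat hl2
  have heq : cost Ω uhat u' = sInf S := by
    refine tendsto_nhds_unique hcost ((hc.comp hns.tendsto_atTop).congr fun j => ?_)
    exact (hcu (ns j)).symm
  rw [heq]
  exact csInf_le hSb ⟨θ'', hθ'', u'', hu'', rfl⟩

end NonlocalControl

open NonlocalControl
theorem mainTheorem1 (n : ℕ) (hn : 0 < n)
    (Ω : Set (Rn n)) (hΩ_open : IsOpen Ω) (hΩ_bdd : Bornology.IsBounded Ω)
    (α : Rn n → Rn n → Rn n) (ε γ₀ : ℝ) (hε : 0 < ε) (hγ₀ : 0 < γ₀)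
    (hα : KernelConditions Ω α ε γ₀)
    (hcase : KernelCase1 Ω α ε ∨ KernelCase2 Ω α ε)
    (θ₀ θ₁ K : ℝ) (hθ₀ : 0 < θ₀)
    (hadm : (admissible Ω α θ₀ θ₁ K).Nonempty)
    (f : constrainedSpace Ω α →ₗ[ℝ] ℝ) (hf : IsEnergyBounded Ω α f)
    (uhat : Rn n → ℝ) (huhat : MemLp uhat 2 (volume.restrict Ω)) :
    ∃ θ ∈ admissible Ω α θ₀ θ₁ K, ∃ u : Rn n → ℝ,
      IsWeakSolution Ω α f θ u ∧
      (∀ᵐ p ∂(volume.restrict (pairDomain Ω α)), θ p.swap = θ p) ∧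
      ∀ θ' ∈ admissible Ω α θ₀ θ₁ K, ∀ u' : Rn n → ℝ,
        IsWeakSolution Ω α f θ' u' → cost Ω uhat u ≤ cost Ω uhat u' := by
  obtain ⟨θ, hθ, u, hu, hmin⟩ :=
    exists_minimizer hn hΩ_open hΩ_bdd hε hγ₀ hα hθ₀ hadm hf huhat
  have hfin := volume_pairDomain_ne_top hΩ_open hΩ_bdd hε hα
  refine ⟨_, symmetrize_mem_admissible hfin hθ, u, hu.symmetrize hα.antisymm hθ.1.1,
    Eventually.of_forall fun p => ?_, hmin⟩
  simp only [Prod.swap_swap]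
  ring
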